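/- Let $P$ be a Borel probability measure on $\mathbb{R}$ with bounded support, and for $r\ge 0$ put $$\psi(r)=\mathbb{E}_{x^*,z}\log\int \exp\Big(\sqrt r\,z x+r x x^*-\frac r2x^2\Big)\,\mathrm dP(x),$$ where $x^*\sim P$ and $z\sim\mathcal N(0,1)$ are independent. For $\lambda,q\ge 0$ let $F(\lambda,q)=\psi(\lambda q)-\frac{\lambda q^2}{4}$, and define the reconstruction threshold $$\lambda_c=\lambda_c(P)=\sup\{\lambda>0:\ q=0 \text{ is the unique maximizer of } F(\lambda,\cdot) \text{ over } [0,\infty)\}\in[0,\infty]$$ (with $\sup\emptyset=0$). For $N\ge1$ let $x^*=(x^*_1,\dots,x^*_N)$ have i.i.d. entries of law $P$, let $W_{ij}$, $1\le i<j\le N$, be i.i.d. $\mathcal N(0,1)$ independent of $x^*$, and let $Y_{ij}=\sqrt{\lambda/N}\,x^*_ix^*_j+W_{ij}$ for $i<j$. For bounded measurable $f$ let $$\langle f(x,x^*)\rangle=\frac{\int f(x,x^*)e^{-H(x)}\,\mathrm dP^{\otimes N}(x)}{\int e^{-H(x)}\,\mathrm dP^{\otimes N}(x)},\qquad -H(x)=\sum_{i<j}\Big(\sqrt{\frac\lambda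 N}\,Y_{ij}x_ix_j-\frac{\lambda}{2N}x_i^2x_j^2\Big),$$ be the average over the posterior law of the spike given $Y$, and let $R_{1,*}=\frac1N\sum_{i=1}^N x_ix^*_i$. **Proposition.** For every $\lambda\ge 0$ and $\epsilon>0$ there is a constant $K=K(\lambda,\epsilon)\ge0$ such that for every $P$ as above with $\lambda<\lambda_c(P)$ there is a constant $c=c(\lambda,\epsilon,P)>0$ such that, for all $N\ge1$, $$\mathbb{E}\big\langle \mathbf 1\{|R_{1,*}|\ge\epsilon\}\big\rangle\le K e^{-cN},$$ where $\mathbb E$ is the expectation over $x^*$ and $W$. -/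

import Mathlib

open MeasureTheory ProbabilityTheory
open scoped ENNReal

noncomputable section

namespace SpikedWigner

/-- The pairs `i < j`: positions of the observed entries (the diagonal is discarded). -/
abbrev Pairs (N : ℕ) : Type := {p : Fin N × Fin N // p.1 < p.2}

/-- The prior `P` has bounded support. -/
def HasBoundedSupport (P : Measure ℝ) : Prop := ∃ B : ℝ, ∀ᵐ x ∂P, |x| ≤ B

/-! ### The replica-symmetric potential and the reconstruction threshold -/

/-- `ψ(r) = 𝔼_{x*, z} log ∫ exp (√r z x + r x x* - r x² / 2) dP(x)`, with `x* ∼ P` and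
`z ∼ 𝒩(0, 1)` independent. -/
def psi (P : Measure ℝ) (r : ℝ) : ℝ :=
  ∫ p : ℝ × ℝ, Real.log (∫ x : ℝ,
    Real.exp (Real.sqrt r * p.2 * x + r * x * p.1 - r / 2 * x ^ 2) ∂P)
    ∂(P.prod (gaussianReal 0 1))

/-- The replica-symmetric potential `F(lam, q) = ψ(lam q) - lam q² / 4`. -/
def rsPotential (P : Measure ℝ) (lam q : ℝ) : ℝ :=
  psi P (lam * q) - lam * q ^ 2 / 4

/-- `q*(lam) = q`: the point `q` is the unique maximizer of `F(lam, ·)` over `[0, ∞)`. -/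
def IsUniqueRSMaximizer (P : Measure ℝ) (lam q : ℝ) : Prop :=
  0 ≤ q ∧ ∀ q' : ℝ, 0 ≤ q' → q' ≠ q → rsPotential P lam q' < rsPotential P lam q

/-- The reconstruction threshold `lam_c = sup {lam > 0 : q*(lam) = 0}`, as an element of `[0, ∞]`
(with value `0` if there is no such `lam`, and `∞` if the set is unbounded). -/
def reconstructionThreshold (P : Measure ℝ) : ℝ≥0∞ :=
  sSup {t : ℝ≥0∞ | ∃ lam : ℝ, 0 < lam ∧ IsUniqueRSMaximizer P lam 0 ∧ t = ENNReal.ofReal lam}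

/-! ### The planted model and the Gibbs measure -/

/-- The law `P^{⊗N}` of a vector with i.i.d. entries of law `P`. -/
def priorN (P : Measure ℝ) (N : ℕ) : Measure (Fin N → ℝ) :=
  Measure.pi fun _ => P

/-- The law of the noise: `W_ij`, `i < j`, i.i.d. standard Gaussian. -/
def noiseLaw (N : ℕ) : Measure (Pairs N → ℝ) :=
  Measure.pi fun _ => gaussianReal 0 1

/-- The observations `Y_ij = √(lam / N) x*_i x*_j + W_ij`, `i < j`. -/
def observation {N : ℕ} (lam : ℝ) (xs : Fin N → ℝ) (W : Pairs N → ℝ) : Pairs N → ℝ :=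
  fun p => Real.sqrt (lam / N) * xs p.1.1 * xs p.1.2 + W p

/-- `-H(x) = ∑_{i<j} (√(lam / N) Y_ij x_i x_j - lam / (2N) x_i² x_j²)`. -/
def negHamiltonian {N : ℕ} (lam : ℝ) (Y : Pairs N → ℝ) (x : Fin N → ℝ) : ℝ :=
  ∑ p : Pairs N, (Real.sqrt (lam / N) * Y p * x p.1.1 * x p.1.2
    - lam / (2 * N) * x p.1.1 ^ 2 * x p.1.2 ^ 2)

/-- The Gibbs average `⟨f⟩ = ∫ f e^{-H} dP^{⊗N} / ∫ e^{-H} dP^{⊗N}`, that is, the mean of `f` under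
the posterior law of the spike given the observations `Y`. -/
def gibbsAverage {N : ℕ} (P : Measure ℝ) (lam : ℝ) (Y : Pairs N → ℝ)
    (f : (Fin N → ℝ) → ℝ) : ℝ :=
  (∫ x, f x * Real.exp (negHamiltonian lam Y x) ∂(priorN P N)) /
    (∫ x, Real.exp (negHamiltonian lam Y x) ∂(priorN P N))

/-- The overlap `R = (1/N) ∑_i x_i x'_i`. -/
def overlap {N : ℕ} (x x' : Fin N → ℝ) : ℝ :=
  (1 / (N : ℝ)) * ∑ i, x i * x' i

/-- `𝔼 ⟨f(x, x*)⟩`: the spike `x* ∼ P^{⊗N}` and the noise `W` are independent, and the Gibbs average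
over `x` is taken at the observations `Y` built from them. -/
def plantedGibbsMean (P : Measure ℝ) (lam : ℝ) (N : ℕ)
    (f : (Fin N → ℝ) → (Fin N → ℝ) → ℝ) : ℝ :=
  ∫ ω : (Fin N → ℝ) × (Pairs N → ℝ),
    gibbsAverage P lam (observation lam ω.1 ω.2) (fun x => f x ω.1)
    ∂((priorN P N).prod (noiseLaw N))

end SpikedWigner

end

set_option linter.unusedSectionVars false

namespace SpikedWigner

section GaussianTools

variable {ι : Type*} [Fintype ι]

/-- The standard Gaussian measure on `ι → ℝ`. -/
noncomputable abbrev stdGaussian (ι : Type*) [Fintype ι] : Measure (ι → ℝ) :=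
  Measure.pi fun _ => gaussianReal 0 1

/-- At most exponential growth. -/
def ExpGrowth (f : (ι → ℝ) → ℝ) : Prop :=
  ∃ A C : ℝ, 0 ≤ A ∧ 0 ≤ C ∧ ∀ g, |f g| ≤ A * Real.exp (C * ∑ k, |g k|)

lemma ExpGrowth.mono {f h : (ι → ℝ) → ℝ} (hh : ExpGrowth h) (hf : ∀ g, |f g| ≤ |h g|) :
    ExpGrowth f := by
  obtain ⟨A, C, hA, hC, H⟩ := hh
  exact ⟨A, C, hA, hC, fun g => (hf g).trans (H g)⟩

lemma ExpGrowth.const (c : ℝ) : ExpGrowth (fun _ : ι → ℝ => c) :=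
  ⟨|c|, 0, abs_nonneg c, le_rfl, fun g => by simp⟩

lemma ExpGrowth.coord (k : ι) : ExpGrowth (fun g : ι → ℝ => g k) := by
  refine ⟨1, 1, zero_le_one, zero_le_one, fun g => ?_⟩
  have h1 : |g k| ≤ ∑ j, |g j| :=
    Finset.single_le_sum (f := fun j => |g j|) (fun j _ => abs_nonneg _) (Finset.mem_univ k)
  have h2 := Real.add_one_le_exp (∑ j, |g j|)
  simp only [one_mul]
  linarith

lemma ExpGrowth.mul {f h : (ι → ℝ) → ℝ} (hf : ExpGrowth f) (hh : ExpGrowth h) :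
    ExpGrowth (fun g => f g * h g) := by
  obtain ⟨A, C, hA, hC, H⟩ := hf
  obtain ⟨A', C', hA', hC', H'⟩ := hh
  refine ⟨A * A', C + C', by positivity, by positivity, fun g => ?_⟩
  rw [abs_mul, add_mul, Real.exp_add]
  calc |f g| * |h g| ≤ (A * Real.exp (C * ∑ k, |g k|)) * (A' * Real.exp (C' * ∑ k, |g k|)) :=
        mul_le_mul (H g) (H' g) (abs_nonneg _) (by positivity)
    _ = _ := by ring

lemma ExpGrowth.add {f h : (ι → ℝ) → ℝ} (hf : ExpGrowth f) (hh : ExpGrowth h) :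
    ExpGrowth (fun g => f g + h g) := by
  obtain ⟨A, C, hA, hC, H⟩ := hf
  obtain ⟨A', C', hA', hC', H'⟩ := hh
  refine ⟨A + A', C + C', by positivity, by positivity, fun g => ?_⟩
  have hs : 0 ≤ ∑ k, |g k| := Finset.sum_nonneg fun _ _ => abs_nonneg _
  have h1 : Real.exp (C * ∑ k, |g k|) ≤ Real.exp ((C + C') * ∑ k, |g k|) :=
    Real.exp_le_exp.2 (mul_le_mul_of_nonneg_right (by linarith) hs)
  have h2 : Real.exp (C' * ∑ k, |g k|) ≤ Real.exp ((C + C') * ∑ k, |g k|) :=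
    Real.exp_le_exp.2 (mul_le_mul_of_nonneg_right (by linarith) hs)
  calc |f g + h g| ≤ |f g| + |h g| := abs_add_le _ _
    _ ≤ A * Real.exp (C * ∑ k, |g k|) + A' * Real.exp (C' * ∑ k, |g k|) := add_le_add (H g) (H' g)
    _ ≤ A * Real.exp ((C + C') * ∑ k, |g k|) + A' * Real.exp ((C + C') * ∑ k, |g k|) := by gcongr
    _ = _ := by ring

lemma ExpGrowth.sum {κ : Type*} (s : Finset κ) {f : κ → (ι → ℝ) → ℝ}
    (hf : ∀ j ∈ s, ExpGrowth (f j)) : ExpGrowth (fun g => ∑ j ∈ s, f j g) := by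
  classical
  induction s using Finset.induction_on with
  | empty => simpa using ExpGrowth.const (ι := ι) 0
  | insert a s ha ih =>
    simp only [Finset.sum_insert ha]
    exact (hf a (by simp)).add (ih fun j hj => hf j (by simp [hj]))

lemma integrable_exp_mul_abs_gaussianReal (C : ℝ) :
    Integrable (fun y => Real.exp (C * |y|)) (gaussianReal 0 1) := by
  refine Integrable.mono' ((integrable_exp_mul_gaussianReal (μ := 0) (v := 1) C).add
    (integrable_exp_mul_gaussianReal (μ := 0) (v := 1) (-C))) (by fun_prop)
    (Filter.Eventually.of_forall fun y => ?_)
  rw [Real.norm_eq_abs, Real.abs_exp]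
  simp only [Pi.add_apply]
  rcases abs_choice y with h | h <;> rw [h]
  · have := Real.exp_pos (-C * y); linarith
  · have := Real.exp_pos (C * y)
    rw [show C * -y = -C * y by ring]; linarith

lemma integrable_exp_mul_sum_abs_stdGaussian (C : ℝ) :
    Integrable (fun g : ι → ℝ => Real.exp (C * ∑ k, |g k|)) (stdGaussian ι) := by
  simp only [Finset.mul_sum, Real.exp_sum]
  exact Integrable.fintype_prod (f := fun (_ : ι) (y : ℝ) => Real.exp (C * |y|))
    (fun _ => integrable_exp_mul_abs_gaussianReal C)

lemma ExpGrowth.integrable {f : (ι → ℝ) → ℝ} (hf : ExpGrowth f)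
    (hm : AEStronglyMeasurable f (stdGaussian ι)) : Integrable f (stdGaussian ι) := by
  obtain ⟨A, C, hA, hC, H⟩ := hf
  exact ((integrable_exp_mul_sum_abs_stdGaussian C).const_mul A).mono' hm
    (Filter.Eventually.of_forall fun g => by rw [Real.norm_eq_abs]; exact H g)

lemma integrable_gaussianReal_iff (f : ℝ → ℝ) :
    Integrable f (gaussianReal 0 1) ↔ Integrable (fun y => gaussianPDFReal 0 1 y * f y) := by
  rw [gaussianReal_of_var_ne_zero 0 one_ne_zero,
    integrable_withDensity_iff_integrable_smul' (measurable_gaussianPDF 0 1)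
      (Filter.Eventually.of_forall fun _ => gaussianPDF_lt_top)]
  simp [toReal_gaussianPDF]

lemma hasDerivAt_gaussianPDFReal (y : ℝ) :
    HasDerivAt (gaussianPDFReal 0 1) (-(y * gaussianPDFReal 0 1 y)) y := by
  have h : HasDerivAt (fun y : ℝ => (Real.sqrt (2 * Real.pi * ((1 : NNReal) : ℝ)))⁻¹ *
      Real.exp (-(y - 0) ^ 2 / (2 * ((1 : NNReal) : ℝ)))) 
      ((Real.sqrt (2 * Real.pi * ((1 : NNReal) : ℝ)))⁻¹ *
      (Real.exp (-(y - 0) ^ 2 / (2 * ((1 : NNReal) : ℝ))) *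
        (-(2 * (y - 0)) / (2 * ((1 : NNReal) : ℝ))))) y := by
    refine ((HasDerivAt.exp ?_).const_mul _)
    have := (((hasDerivAt_id y).sub_const 0).pow 2).neg.div_const (2 * ((1 : NNReal) : ℝ))
    simpa using this
  rw [gaussianPDFReal_def]
  convert h using 1
  simp
  ring

/-- Gaussian integration by parts on the line. -/
lemma integral_mul_gaussianReal_eq {f f' : ℝ → ℝ} (hf : ∀ y, HasDerivAt f (f' y) y)
    (hi : Integrable f (gaussianReal 0 1)) (hi' : Integrable f' (gaussianReal 0 1))
    (hiy : Integrable (fun y => y * f y) (gaussianReal 0 1)) :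
    ∫ y, y * f y ∂(gaussianReal 0 1) = ∫ y, f' y ∂(gaussianReal 0 1) := by
  have key := integral_mul_deriv_eq_deriv_mul_of_integrable (u := f) (u' := f')
    (v := gaussianPDFReal 0 1) (v' := fun y => -(y * gaussianPDFReal 0 1 y))
    (fun y _ => hf y) (fun y _ => hasDerivAt_gaussianPDFReal y) 
    (((integrable_gaussianReal_iff _).1 hiy).neg.congr (Filter.Eventually.of_forall fun y => by
      simp only [Pi.neg_apply, Pi.mul_apply]; ring))
    (((integrable_gaussianReal_iff _).1 hi').congr (Filter.Eventually.of_forall fun y => by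
      simp only [Pi.mul_apply]; ring))
    (((integrable_gaussianReal_iff _).1 hi).congr (Filter.Eventually.of_forall fun y => by
      simp only [Pi.mul_apply]; ring))
  rw [integral_gaussianReal_eq_integral_smul one_ne_zero,
    integral_gaussianReal_eq_integral_smul one_ne_zero]
  have e1 : ∫ y, gaussianPDFReal 0 1 y • (y * f y) =
      -∫ y, f y * -(y * gaussianPDFReal 0 1 y) := by
    rw [← integral_neg]; congr 1; ext y; simp only [smul_eq_mul]; ring
  rw [e1, key, neg_neg]
  congr 1; ext y; simp only [smul_eq_mul]; ring

lemma measurePreserving_update [DecidableEq ι] {X : ι → Type*} [∀ i, MeasurableSpace (X i)]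
    (μ : ∀ i, Measure (X i)) [∀ i, IsProbabilityMeasure (μ i)] (k : ι) :
    MeasurePreserving (fun p : (∀ i, X i) × X k => Function.update p.1 k p.2)
      ((Measure.pi μ).prod (μ k)) (Measure.pi μ) := by
  have hm : Measurable (fun p : (∀ i, X i) × X k => Function.update p.1 k p.2) := by
    refine measurable_pi_lambda _ fun i => ?_
    by_cases h : i = k
    · subst h; simpa using measurable_snd
    · simp only [Function.update_of_ne h]
      exact (measurable_pi_apply i).comp measurable_fst
  refine ⟨hm, (Measure.pi_eq fun s hs => ?_).symm⟩
  rw [Measure.map_apply hm (MeasurableSet.univ_pi hs)]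
  have : (fun p : (∀ i, X i) × X k => Function.update p.1 k p.2) ⁻¹' (Set.univ.pi s) =
      (Set.univ.pi (Function.update s k Set.univ)) ×ˢ (s k) := by
    ext ⟨g, y⟩
    simp only [Set.mem_preimage, Set.mem_univ_pi, Set.mem_prod]
    constructor
    · refine fun h => ⟨fun i => ?_, by simpa using h k⟩
      by_cases hi : i = k
      · subst hi; simp
      · simpa [Function.update_of_ne hi] using h i
    · rintro ⟨h, hy⟩ i
      by_cases hi : i = k
      · subst hi; simpa using hy
      · simpa [Function.update_of_ne hi] using h i
  rw [this, Measure.prod_prod, Measure.pi_pi, ← Finset.mul_prod_erase _ _ (Finset.mem_univ k),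
    ← Finset.mul_prod_erase (s := Finset.univ) (fun i => μ i (s i)) (Finset.mem_univ k)]
  simp only [Function.update_self, measure_univ, one_mul]
  rw [mul_comm]
  congr 1
  refine Finset.prod_congr rfl fun i hi => ?_
  rw [Function.update_of_ne (Finset.ne_of_mem_erase hi)]

/-- Gaussian integration by parts in the coordinate `k`. -/
lemma integral_coord_mul_stdGaussian_eq [DecidableEq ι] {f f' : (ι → ℝ) → ℝ} (k : ι)
    (hf : ∀ g, HasDerivAt (fun y => f (Function.update g k y)) (f' g) (g k))
    (hc : Continuous f) (hc' : Continuous f') (hg : ExpGrowth f) (hg' : ExpGrowth f') :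
    ∫ g, g k * f g ∂(stdGaussian ι) = ∫ g, f' g ∂(stdGaussian ι) := by
  have mp := measurePreserving_update (fun _ : ι => gaussianReal 0 1) k
  have step : ∀ F : (ι → ℝ) → ℝ, Integrable F (stdGaussian ι) →
      ∫ g, F g ∂(stdGaussian ι) =
        ∫ g, ∫ y, F (Function.update g k y) ∂(gaussianReal 0 1) ∂(stdGaussian ι) := by
    intro F hF
    rw [← integral_prod (f := fun p : (ι → ℝ) × ℝ => F (Function.update p.1 k p.2))
      (mp.integrable_comp_of_integrable hF)]
    conv_lhs => rw [stdGaussian, ← mp.map_eq]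
    rw [integral_map mp.measurable.aemeasurable (by rw [mp.map_eq]; exact hF.aestronglyMeasurable)]
  have i1 : Integrable (fun g => g k * f g) (stdGaussian ι) :=
    ((ExpGrowth.coord k).mul hg).integrable (by fun_prop)
  rw [step _ i1, step _ (hg'.integrable (by fun_prop))]
  refine integral_congr_ae (Filter.Eventually.of_forall fun g => ?_)
  have line : ∀ F : (ι → ℝ) → ℝ, Continuous F → ExpGrowth F →
      Integrable (fun y => F (Function.update g k y)) (gaussianReal 0 1) := by
    rintro F hF ⟨A, C, hA, hC, H⟩
    refine ((integrable_exp_mul_abs_gaussianReal C).const_mul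
      (A * Real.exp (C * ∑ j ∈ Finset.univ.erase k, |g j|))).mono'
      (by have := hF.comp (continuous_const.update k continuous_id (f := fun _ : ℝ => g))
          exact this.aestronglyMeasurable)
      (Filter.Eventually.of_forall fun y => ?_)
    rw [Real.norm_eq_abs]
    refine (H _).trans (le_of_eq ?_)
    rw [mul_assoc, ← Real.exp_add, ← mul_add,
      ← Finset.add_sum_erase Finset.univ _ (Finset.mem_univ k), Function.update_self, add_comm]
    congr 4
    refine Finset.sum_congr rfl fun i hi => ?_
    rw [Function.update_of_ne (Finset.ne_of_mem_erase hi)]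
  have e := integral_mul_gaussianReal_eq (f := fun y => f (Function.update g k y))
    (f' := fun y => f' (Function.update g k y)) (fun y => by
      have := hf (Function.update g k y)
      simpa using this) (line f hc hg) (line f' hc' hg')
      (by simpa using line (fun g => g k * f g) (by fun_prop) ((ExpGrowth.coord k).mul hg))
  simpa using e

lemma lintegral_gaussianReal_add (c : ℝ) {F : ℝ → ℝ≥0∞} (hF : Measurable F) :
    ∫⁻ y, F (y + c) ∂(gaussianReal 0 1) =
      ∫⁻ y, ENNReal.ofReal (Real.exp (c * y - c ^ 2 / 2)) * F y ∂(gaussianReal 0 1) := by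
  rw [← lintegral_map hF (measurable_add_const c), gaussianReal_map_add_const,
    gaussianReal_of_var_ne_zero _ one_ne_zero, gaussianReal_of_var_ne_zero _ one_ne_zero,
    lintegral_withDensity_eq_lintegral_mul _ (measurable_gaussianPDF _ _) hF,
    lintegral_withDensity_eq_lintegral_mul _ (measurable_gaussianPDF _ _) (by fun_prop)]
  refine lintegral_congr fun y => ?_
  simp only [Pi.mul_apply, gaussianPDF]
  rw [← mul_assoc, ← ENNReal.ofReal_mul (gaussianPDFReal_nonneg _ _ _)]
  congr 2
  rw [gaussianPDFReal_def, gaussianPDFReal_def]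
  simp only [mul_assoc, ← Real.exp_add]
  congr 2
  simp
  ring

lemma integrable_exp_mul_sub (c d : ℝ) :
    Integrable (fun y => Real.exp (c * y - d)) (gaussianReal 0 1) := by
  simp only [Real.exp_sub]
  exact (integrable_exp_mul_gaussianReal c).div_const _

lemma map_add_stdGaussian (c : ι → ℝ) :
    (stdGaussian ι).map (fun g => g + c) = (stdGaussian ι).withDensity
      (fun g => ENNReal.ofReal (Real.exp (∑ k, (c k * g k - c k ^ 2 / 2)))) := by
  have h1 : (stdGaussian ι).map (fun g => g + c) =
      Measure.pi fun k => (gaussianReal 0 1).map (fun y => y + c k) :=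
    Measure.pi_map_pi (fun k => (measurable_add_const (c k)).aemeasurable)
  rw [h1]
  refine Measure.pi_eq fun s hs => ?_
  have fac : ∀ k, (gaussianReal 0 1).map (fun y => y + c k) (s k) = ENNReal.ofReal
      (∫ y, Real.exp (c k * y - c k ^ 2 / 2) ∂((gaussianReal 0 1).restrict (s k))) := by
    intro k
    rw [ofReal_integral_eq_lintegral_ofReal
      (integrable_exp_mul_sub (c k) (c k ^ 2 / 2)).restrict
      (Filter.Eventually.of_forall fun _ => (Real.exp_pos _).le)]
    have := lintegral_gaussianReal_add (c k) (measurable_one.indicator (hs k) (f := 1))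
    rw [← lintegral_map (measurable_one.indicator (hs k)) (measurable_add_const (c k)),
      lintegral_indicator_one (hs k)] at this
    rw [this, ← lintegral_indicator (hs k)]
    refine lintegral_congr fun y => ?_
    by_cases hy : y ∈ s k <;> simp [hy]
  rw [withDensity_apply _ (MeasurableSet.univ_pi hs), stdGaussian, Measure.restrict_pi_pi]
  simp only [fac]
  rw [← ENNReal.ofReal_prod_of_nonneg
    (fun k _ => integral_nonneg fun _ => (Real.exp_pos _).le),
    ← integral_fintype_prod_eq_prod (fun k (y : ℝ) => Real.exp (c k * y - c k ^ 2 / 2)),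
    ← ofReal_integral_eq_lintegral_ofReal _
      (Filter.Eventually.of_forall fun _ => (Real.exp_pos _).le)]
  · simp only [Real.exp_sum]
  · simp only [Real.exp_sum]
    exact Integrable.fintype_prod (f := fun k (y : ℝ) => Real.exp (c k * y - c k ^ 2 / 2))
      (fun k => (integrable_exp_mul_sub (c k) (c k ^ 2 / 2)).restrict)

/-- The Cameron-Martin formula. -/
lemma lintegral_stdGaussian_add (c : ι → ℝ) {F : (ι → ℝ) → ℝ≥0∞} (hF : Measurable F) :
    ∫⁻ g, F (g + c) ∂(stdGaussian ι) = ∫⁻ g, ENNReal.ofReal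
      (Real.exp (∑ k, (c k * g k - c k ^ 2 / 2))) * F g ∂(stdGaussian ι) := by
  rw [← lintegral_map hF (measurable_add_const c), map_add_stdGaussian,
    lintegral_withDensity_eq_lintegral_mul _ (by fun_prop) hF]
  rfl

end GaussianTools

section ExponentialIntegral

variable {X κ : Type*} [MeasurableSpace X] [Fintype κ]

/-- The integral of `φ` against the exponential tilt of `μ` by the linear statistics `v`. -/
noncomputable def expInt (μ : Measure X) (v : κ → X → ℝ) (φ : X → ℝ) (h : κ → ℝ) : ℝ :=
  ∫ x, φ x * Real.exp (∑ j, h j * v j x) ∂μ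

variable {μ : Measure X} [IsFiniteMeasure μ] {v : κ → X → ℝ} {φ : X → ℝ} {C D : ℝ}

lemma abs_sum_mul_le {v : κ → ℝ} {C : ℝ} (hb : ∀ j, |v j| ≤ C) (h : κ → ℝ) :
    |∑ j, h j * v j| ≤ C * ∑ j, |h j| := by
  rw [Finset.mul_sum]
  refine (Finset.abs_sum_le_sum_abs _ _).trans (Finset.sum_le_sum fun j _ => ?_)
  rw [abs_mul, mul_comm]
  exact mul_le_mul_of_nonneg_right (hb j) (abs_nonneg _)

lemma integrable_mul_exp_sum (hv : ∀ j, Measurable (v j)) (hb : ∀ᵐ x ∂μ, ∀ j, |v j x| ≤ C)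
    (hφ : Measurable φ) (hφb : ∀ᵐ x ∂μ, |φ x| ≤ D) (h : κ → ℝ) :
    Integrable (fun x => φ x * Real.exp (∑ j, h j * v j x)) μ := by
  refine Integrable.mono' (integrable_const (D * Real.exp (C * ∑ j, |h j|)))
    (by fun_prop) ?_
  filter_upwards [hb, hφb] with x hx hx'
  rw [norm_mul, Real.norm_eq_abs, Real.norm_eq_abs, Real.abs_exp]
  have := (abs_nonneg _).trans hx'
  exact mul_le_mul hx' (Real.exp_le_exp.2 ((le_abs_self _).trans (abs_sum_mul_le hx h)))
    (Real.exp_pos _).le this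

lemma hasFDerivAt_expInt (hv : ∀ j, Measurable (v j)) (hb : ∀ᵐ x ∂μ, ∀ j, |v j x| ≤ C)
    (hφ : Measurable φ) (hφb : ∀ᵐ x ∂μ, |φ x| ≤ D) (h : κ → ℝ) :
    HasFDerivAt (expInt μ v φ)
      (∑ j, expInt μ v (fun x => φ x * v j x) h •
        (ContinuousLinearMap.proj (R := ℝ) (φ := fun _ : κ => ℝ) j)) h := by
  set pr : κ → ((κ → ℝ) →L[ℝ] ℝ) := fun j =>
    ContinuousLinearMap.proj (R := ℝ) (φ := fun _ : κ => ℝ) j with hpr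
  have hint : ∀ j, Integrable (fun x => φ x * v j x * Real.exp (∑ i, h i * v i x)) μ := fun j =>
    integrable_mul_exp_sum (D := D * C) hv hb (hφ.mul (hv j)) (by
      simp only [Pi.mul_apply]
      filter_upwards [hb, hφb] with x hx hx'
      rw [abs_mul]
      exact mul_le_mul hx' (hx j) (abs_nonneg _) ((abs_nonneg _).trans hx')) h
  have key := hasFDerivAt_integral_of_dominated_of_fderiv_le (μ := μ) (x₀ := h)
    (s := Metric.ball h 1)
    (F := fun h x => φ x * Real.exp (∑ j, h j * v j x))
    (F' := fun h x => ∑ j, (φ x * v j x * Real.exp (∑ i, h i * v i x)) • pr j)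
    (bound := fun _ => ∑ j, (D * C * Real.exp (C * ∑ i, (|h i| + 1))) * ‖pr j‖)
    (Metric.ball_mem_nhds h one_pos)
    (Filter.Eventually.of_forall fun h => by fun_prop)
    (integrable_mul_exp_sum hv hb hφ hφb h) (by fun_prop) ?_ (integrable_const _) ?_
  · refine key.congr_fderiv ?_
    rw [integral_finsetSum _ fun j _ => (hint j).smul_const (pr j)]
    simp only [integral_smul_const]
    rfl
  · filter_upwards [hb, hφb] with x hx hx' y hy
    refine (norm_sum_le _ _).trans (Finset.sum_le_sum fun j _ => ?_)
    rw [norm_smul]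
    refine mul_le_mul_of_nonneg_right ?_ (norm_nonneg _)
    have hC : 0 ≤ C := (abs_nonneg _).trans (hx j)
    have hD : 0 ≤ D := (abs_nonneg _).trans hx'
    rw [Real.norm_eq_abs, abs_mul, abs_mul, Real.abs_exp]
    refine mul_le_mul (mul_le_mul hx' (hx j) (abs_nonneg _) hD) (Real.exp_le_exp.2 ?_)
      (Real.exp_pos _).le (by positivity)
    refine (le_abs_self _).trans ((abs_sum_mul_le hx y).trans ?_)
    refine mul_le_mul_of_nonneg_left (Finset.sum_le_sum fun i _ => ?_) hC
    have h1 : |y i - h i| ≤ 1 := by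
      have := (norm_le_pi_norm (y - h) i).trans (mem_ball_iff_norm.1 hy).le
      simpa using this
    have := abs_sub_abs_le_abs_sub (y i) (h i)
    linarith
  · refine Filter.Eventually.of_forall fun x y _ => ?_
    have h1 : HasFDerivAt (fun y : κ → ℝ => ∑ j, y j * v j x) (∑ j, v j x • pr j) y := by
      refine HasFDerivAt.fun_sum fun j _ => ?_
      have := (pr j).hasFDerivAt (x := y)
      exact this.mul_const (v j x)
    have h2 := (h1.exp).const_mul (φ x)
    refine h2.congr_fderiv ?_
    rw [Finset.smul_sum, Finset.smul_sum]
    refine Finset.sum_congr rfl fun j _ => ?_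
    rw [smul_smul, smul_smul]
    congr 1
    ring

lemma continuous_expInt (hv : ∀ j, Measurable (v j)) (hb : ∀ᵐ x ∂μ, ∀ j, |v j x| ≤ C)
    (hφ : Measurable φ) (hφb : ∀ᵐ x ∂μ, |φ x| ≤ D) : Continuous (expInt μ v φ) :=
  continuous_iff_continuousAt.2 fun h => (hasFDerivAt_expInt hv hb hφ hφb h).continuousAt

lemma hasDerivAt_expInt_comp (hv : ∀ j, Measurable (v j)) (hb : ∀ᵐ x ∂μ, ∀ j, |v j x| ≤ C)
    (hφ : Measurable φ) (hφb : ∀ᵐ x ∂μ, |φ x| ≤ D) {H : ℝ → κ → ℝ} {H' : κ → ℝ} {t : ℝ}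
    (hH : ∀ j, HasDerivAt (fun s => H s j) (H' j) t) :
    HasDerivAt (fun s => expInt μ v φ (H s))
      (∑ j, H' j * expInt μ v (fun x => φ x * v j x) (H t)) t := by
  have := (hasFDerivAt_expInt hv hb hφ hφb (H t)).comp_hasDerivAt t (hasDerivAt_pi.2 hH)
  refine this.congr_deriv ?_
  rw [_root_.sum_apply]
  exact Finset.sum_congr rfl fun j _ => by simp [mul_comm]

lemma expInt_one_pos (hv : ∀ j, Measurable (v j)) (hb : ∀ᵐ x ∂μ, ∀ j, |v j x| ≤ C)
    (hμ : μ ≠ 0) (h : κ → ℝ) : 0 < expInt μ v (fun _ => 1) h := by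
  have : NeZero μ := ⟨hμ⟩
  have hi := integrable_mul_exp_sum (φ := fun _ => 1) (D := 1) hv hb measurable_const
    (by simp) h
  simp only [one_mul] at hi
  simp only [expInt, one_mul]
  exact integral_exp_pos hi

lemma expInt_one_le (hb : ∀ᵐ x ∂μ, ∀ j, |v j x| ≤ C) (h : κ → ℝ) :
    expInt μ v (fun _ => 1) h ≤ μ.real Set.univ * Real.exp (C * ∑ j, |h j|) := by
  simp only [expInt, one_mul]
  rw [← smul_eq_mul, ← integral_const]
  refine integral_mono_of_nonneg (Filter.Eventually.of_forall fun _ => (Real.exp_pos _).le)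
    (integrable_const _) ?_
  filter_upwards [hb] with x hx
  exact Real.exp_le_exp.2 ((le_abs_self _).trans (abs_sum_mul_le hx h))

lemma abs_expInt_le (hv : ∀ j, Measurable (v j)) (hb : ∀ᵐ x ∂μ, ∀ j, |v j x| ≤ C)
    (hφb : ∀ᵐ x ∂μ, |φ x| ≤ D) (h : κ → ℝ) :
    |expInt μ v φ h| ≤ D * expInt μ v (fun _ => 1) h := by
  have hi := integrable_mul_exp_sum (φ := fun _ => 1) (D := 1) hv hb measurable_const
    (by simp) h
  simp only [expInt]
  rw [← integral_const_mul]
  rw [← Real.norm_eq_abs]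
  refine (norm_integral_le_integral_norm _).trans ?_
  refine integral_mono_of_nonneg (Filter.Eventually.of_forall fun _ => norm_nonneg _)
    (hi.const_mul D) ?_
  filter_upwards [hφb] with x hx
  rw [norm_mul, Real.norm_eq_abs, Real.norm_eq_abs, Real.abs_exp, one_mul]
  exact mul_le_mul_of_nonneg_right hx (Real.exp_pos _).le

end ExponentialIntegral

section Interpolation

variable {X ι : Type*} [MeasurableSpace X] [Fintype ι]

/-- Sufficient statistics of the interpolating Hamiltonian. -/
noncomputable def interpStat (u : ι → X → ℝ) (c : ι → ℝ) : ι ⊕ ι → X → ℝ :=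
  Sum.elim u fun k x => c k * u k x - u k x ^ 2 / 2

/-- Natural parameters of the interpolating Hamiltonian. -/
def interpParam (a g : ι → ℝ) : ι ⊕ ι → ℝ :=
  Sum.elim (fun k => a k * g k) fun k => a k ^ 2

variable {μ : Measure X} [IsFiniteMeasure μ] {u : ι → X → ℝ} {c : ι → ℝ} {φ : X → ℝ} {C D θ : ℝ}

lemma measurable_interpStat (hu : ∀ k, Measurable (u k)) (j : ι ⊕ ι) :
    Measurable (interpStat u c j) := by
  rcases j with k | k
  · exact hu k
  · have := hu k
    simp only [interpStat, Sum.elim_inr]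
    fun_prop

lemma interpStat_bdd (hb : ∀ᵐ x ∂μ, ∀ k, |u k x| ≤ C) :
    ∀ᵐ x ∂μ, ∀ j, |interpStat u c j x| ≤ C + (∑ k, |c k|) * C + C ^ 2 / 2 := by
  filter_upwards [hb] with x hx j
  have key : ∀ k, 0 ≤ C ∧ |c k| * |u k x| ≤ (∑ k, |c k|) * C ∧ |u k x| ^ 2 ≤ C ^ 2 := fun k => by
    have hC := (abs_nonneg _).trans (hx k)
    refine ⟨hC, mul_le_mul (Finset.single_le_sum (f := fun j => |c j|)
      (fun j _ => abs_nonneg _) (Finset.mem_univ k)) (hx k) (abs_nonneg _)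
      (Finset.sum_nonneg fun _ _ => abs_nonneg _), ?_⟩
    gcongr
    exact hx k
  rcases j with k | k <;> obtain ⟨h0, h1, h2⟩ := key k
  · have h3 : 0 ≤ |c k| * |u k x| := by positivity
    simp only [interpStat, Sum.elim_inl]
    nlinarith [hx k, sq_nonneg C]
  · simp only [interpStat, Sum.elim_inr]
    refine (abs_sub _ _).trans ?_
    rw [abs_mul, abs_div, abs_pow, abs_two]
    linarith

lemma continuous_interpParam (a : ι → ℝ) : Continuous (interpParam a) := by
  refine continuous_pi fun j => ?_
  rcases j with k | k <;> simp only [interpParam, Sum.elim_inl, Sum.elim_inr] <;> fun_prop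

lemma sum_abs_interpParam_le {a : ι → ℝ} (ha : ∀ k, |a k| ≤ 1) (g : ι → ℝ) :
    ∑ j, |interpParam a g j| ≤ Fintype.card ι + ∑ k, |g k| := by
  rw [Fintype.sum_sum_type, add_comm]
  simp only [interpParam, Sum.elim_inl, Sum.elim_inr]
  refine add_le_add ?_ (Finset.sum_le_sum fun k _ => ?_)
  · rw [Fintype.card, Finset.cast_card]
    refine Finset.sum_le_sum fun k _ => ?_
    rw [abs_pow]
    exact pow_le_one₀ (abs_nonneg _) (ha k)
  · rw [abs_mul]
    exact mul_le_of_le_one_left (abs_nonneg _) (ha k)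

/-- The interpolating Gibbs integral of `φ`. -/
noncomputable def interpInt (μ : Measure X) (u : ι → X → ℝ) (c : ι → ℝ) (φ : X → ℝ)
    (a g : ι → ℝ) : ℝ :=
  expInt μ (interpStat u c) φ (interpParam a g)

/-- The interpolating partition function. -/
noncomputable abbrev interpZ (μ : Measure X) (u : ι → X → ℝ) (c : ι → ℝ) (a g : ι → ℝ) : ℝ :=
  interpInt μ u c (fun _ => 1) a g

lemma interpInt_eq (μ : Measure X) (u : ι → X → ℝ) (c : ι → ℝ) (φ : X → ℝ) (a g : ι → ℝ) :
    interpInt μ u c φ a g = ∫ x, φ x * Real.exp (∑ k, (a k * g k * u k x +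
      a k ^ 2 * (c k * u k x - u k x ^ 2 / 2))) ∂μ := by
  simp only [interpInt, expInt, Fintype.sum_sum_type, interpParam, interpStat, Sum.elim_inl,
    Sum.elim_inr, Finset.sum_add_distrib]

lemma continuous_interpInt (hu : ∀ k, Measurable (u k)) (hb : ∀ᵐ x ∂μ, ∀ k, |u k x| ≤ C)
    (hφ : Measurable φ) (hφb : ∀ᵐ x ∂μ, |φ x| ≤ D) (a : ι → ℝ) :
    Continuous (interpInt μ u c φ a) :=
  (continuous_expInt (measurable_interpStat hu) (interpStat_bdd hb) hφ hφb).comp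
    (continuous_interpParam a)

lemma interpZ_pos (hu : ∀ k, Measurable (u k)) (hb : ∀ᵐ x ∂μ, ∀ k, |u k x| ≤ C) (hμ : μ ≠ 0)
    (a g : ι → ℝ) : 0 < interpZ μ u c a g :=
  expInt_one_pos (measurable_interpStat hu) (interpStat_bdd hb) hμ _

lemma abs_interpInt_le (hu : ∀ k, Measurable (u k)) (hb : ∀ᵐ x ∂μ, ∀ k, |u k x| ≤ C)
    (hφb : ∀ᵐ x ∂μ, |φ x| ≤ D) (a g : ι → ℝ) :
    |interpInt μ u c φ a g| ≤ D * interpZ μ u c a g :=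
  abs_expInt_le (measurable_interpStat hu) (interpStat_bdd hb) hφb _

lemma exists_interpZ_rpow_le (hb : ∀ᵐ x ∂μ, ∀ k, |u k x| ≤ C) (hC : 0 ≤ C) (hθ : 0 ≤ θ)
    (hu : ∀ k, Measurable (u k)) (hμ : μ ≠ 0) :
    ∃ A K : ℝ, 0 ≤ A ∧ 0 ≤ K ∧ ∀ a : ι → ℝ, (∀ k, |a k| ≤ 1) → ∀ g,
      interpZ μ u c a g ^ θ ≤ A * Real.exp (K * ∑ k, |g k|) := by
  set L : ℝ := C + (∑ k, |c k|) * C + C ^ 2 / 2 with hL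
  have hL0 : 0 ≤ L := by
    have : 0 ≤ ∑ k, |c k| := Finset.sum_nonneg fun _ _ => abs_nonneg _
    positivity
  refine ⟨(μ.real Set.univ * Real.exp (L * Fintype.card ι)) ^ θ, L * θ, by positivity,
    by positivity, fun a ha g => ?_⟩
  calc interpZ μ u c a g ^ θ
      ≤ (μ.real Set.univ * Real.exp (L * (Fintype.card ι + ∑ k, |g k|))) ^ θ := by
        refine Real.rpow_le_rpow (interpZ_pos hu hb hμ a g).le ?_ hθ
        refine (expInt_one_le (interpStat_bdd hb) _).trans ?_
        refine mul_le_mul_of_nonneg_left (Real.exp_le_exp.2 ?_) measureReal_nonneg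
        exact mul_le_mul_of_nonneg_left (sum_abs_interpParam_le ha g) hL0
    _ = _ := by
        rw [mul_add, Real.exp_add, ← mul_assoc, Real.mul_rpow (by positivity) (by positivity),
          ← Real.exp_mul]
        ring_nf

lemma hasDerivAt_interpInt_time (hu : ∀ k, Measurable (u k)) (hb : ∀ᵐ x ∂μ, ∀ k, |u k x| ≤ C)
    (hφ : Measurable φ) (hφb : ∀ᵐ x ∂μ, |φ x| ≤ D) {a : ℝ → ι → ℝ} {a' : ι → ℝ} {s : ℝ}
    (ha : ∀ k, HasDerivAt (fun s => a s k) (a' k) s) (g : ι → ℝ) :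
    HasDerivAt (fun s => interpInt μ u c φ (a s) g)
      (∑ k, (a' k * g k * interpInt μ u c (fun x => φ x * u k x) (a s) g +
        2 * a s k * a' k *
          interpInt μ u c (fun x => φ x * (c k * u k x - u k x ^ 2 / 2)) (a s) g)) s := by
  have := hasDerivAt_expInt_comp (measurable_interpStat (c := c) hu) (interpStat_bdd hb) hφ hφb
    (H := fun s => interpParam (a s) g) (t := s)
    (H' := Sum.elim (fun k => a' k * g k) fun k => 2 * a s k * a' k) (by
      rintro (k | k)
      · exact (ha k).mul_const (g k)
      · have := (ha k).pow 2
        simpa [interpParam, Pi.pow_def] using this)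
  rw [Fintype.sum_sum_type] at this
  rw [Finset.sum_add_distrib]
  exact this

lemma hasDerivAt_interpInt_coord [DecidableEq ι] (hu : ∀ k, Measurable (u k))
    (hb : ∀ᵐ x ∂μ, ∀ k, |u k x| ≤ C)
    (hφ : Measurable φ) (hφb : ∀ᵐ x ∂μ, |φ x| ≤ D) (a g : ι → ℝ) (k : ι) :
    HasDerivAt (fun y => interpInt μ u c φ a (Function.update g k y))
      (a k * interpInt μ u c (fun x => φ x * u k x) a g) (g k) := by
  have := hasDerivAt_expInt_comp (measurable_interpStat (c := c) hu) (interpStat_bdd hb) hφ hφb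
    (H := fun y => interpParam a (Function.update g k y)) (t := g k)
    (H' := Sum.elim (Pi.single k (a k)) 0) (by
      rintro (j | j)
      · by_cases h : j = k
        · subst h
          simpa [interpParam] using (hasDerivAt_id (g j)).const_mul (a j)
        · simpa [interpParam, h] using hasDerivAt_const (g k) (a j * g j)
      · simpa [interpParam] using hasDerivAt_const (g k) (a j ^ 2))
  rw [Fintype.sum_sum_type] at this
  simpa [Function.update_eq_self, Pi.single_apply, interpInt, interpStat] using this

end Interpolation

section InterpolationDerivative

variable {X ι : Type*} [MeasurableSpace X] [Fintype ι]
variable {μ : Measure X} [IsFiniteMeasure μ] {u : ι → X → ℝ} {c : ι → ℝ} {φ : X → ℝ} {C D θ : ℝ}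

/-- The Gibbs average of `φ` under the interpolating measure. -/
noncomputable def interpMean (μ : Measure X) (u : ι → X → ℝ) (c : ι → ℝ) (φ : X → ℝ)
    (a g : ι → ℝ) : ℝ :=
  interpInt μ u c φ a g / interpZ μ u c a g

lemma abs_interpMean_le (hu : ∀ k, Measurable (u k)) (hb : ∀ᵐ x ∂μ, ∀ k, |u k x| ≤ C)
    (hμ : μ ≠ 0) (hφb : ∀ᵐ x ∂μ, |φ x| ≤ D) (a g : ι → ℝ) :
    |interpMean μ u c φ a g| ≤ D := by
  have hZ := interpZ_pos (c := c) hu hb hμ a g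
  rw [interpMean, abs_div, abs_of_pos hZ, div_le_iff₀ hZ]
  exact abs_interpInt_le hu hb hφb a g

lemma continuous_interpMean (hu : ∀ k, Measurable (u k)) (hb : ∀ᵐ x ∂μ, ∀ k, |u k x| ≤ C)
    (hμ : μ ≠ 0) (hφ : Measurable φ) (hφb : ∀ᵐ x ∂μ, |φ x| ≤ D) (a : ι → ℝ) :
    Continuous (interpMean μ u c φ a) :=
  (continuous_interpInt hu hb hφ hφb a).div
    (continuous_interpInt (D := 1) hu hb measurable_const (by simp) a)
    fun g => (interpZ_pos hu hb hμ a g).ne'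

lemma continuous_interpZ_rpow (hu : ∀ k, Measurable (u k)) (hb : ∀ᵐ x ∂μ, ∀ k, |u k x| ≤ C)
    (hμ : μ ≠ 0) (a : ι → ℝ) (θ : ℝ) : Continuous (fun g => interpZ μ u c a g ^ θ) :=
  (continuous_interpInt (D := 1) hu hb measurable_const (by simp) a).rpow_const
    fun g => Or.inl (interpZ_pos hu hb hμ a g).ne'

lemma expGrowth_interpZ_rpow (hu : ∀ k, Measurable (u k)) (hb : ∀ᵐ x ∂μ, ∀ k, |u k x| ≤ C)
    (hμ : μ ≠ 0) (hC : 0 ≤ C) (hθ : 0 ≤ θ) {a : ι → ℝ} (ha : ∀ k, |a k| ≤ 1) :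
    ExpGrowth (fun g => interpZ μ u c a g ^ θ) := by
  obtain ⟨A, K, hA, hK, H⟩ := exists_interpZ_rpow_le (c := c) hb hC hθ hu hμ
  refine ⟨A, K, hA, hK, fun g => ?_⟩
  rw [abs_of_nonneg (Real.rpow_nonneg (interpZ_pos hu hb hμ a g).le θ)]
  exact H a ha g

lemma expGrowth_interpMean (hu : ∀ k, Measurable (u k)) (hb : ∀ᵐ x ∂μ, ∀ k, |u k x| ≤ C)
    (hμ : μ ≠ 0) (hφb : ∀ᵐ x ∂μ, |φ x| ≤ D) (a : ι → ℝ) :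
    ExpGrowth (interpMean μ u c φ a) :=
  (ExpGrowth.const D).mono fun g =>
    (abs_interpMean_le hu hb hμ hφb a g).trans (le_abs_self D)

/-- Gaussian integration by parts for the interpolating Gibbs measure. -/
lemma integral_coord_mul_interpMean (hu : ∀ k, Measurable (u k)) (hb : ∀ᵐ x ∂μ, ∀ k, |u k x| ≤ C)
    (hμ : μ ≠ 0) (hC : 0 ≤ C) (hθ : 0 ≤ θ) {a : ι → ℝ} (ha : ∀ k, |a k| ≤ 1) (k : ι) :
    ∫ g, g k * (interpZ μ u c a g ^ θ * interpMean μ u c (u k) a g) ∂(stdGaussian ι) =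
      ∫ g, a k * (interpZ μ u c a g ^ θ * (interpMean μ u c (fun x => u k x ^ 2) a g -
        (1 - θ) * interpMean μ u c (u k) a g ^ 2)) ∂(stdGaussian ι) := by
  classical
  have hbk : ∀ᵐ x ∂μ, |u k x| ≤ C := hb.mono fun x hx => hx k
  have hbk2 : ∀ᵐ x ∂μ, |u k x ^ 2| ≤ C ^ 2 := hbk.mono fun x hx => by
    rw [abs_pow]; gcongr
  have hum2 : Measurable fun x => u k x ^ 2 := (hu k).pow_const 2
  have c1 := continuous_interpMean (c := c) hu hb hμ (hu k) hbk a
  have c2 := continuous_interpMean (c := c) hu hb hμ hum2 hbk2 a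
  have c0 := continuous_interpZ_rpow (c := c) hu hb hμ a θ
  have e1 := expGrowth_interpMean (c := c) hu hb hμ hbk a
  have e2 := expGrowth_interpMean (c := c) hu hb hμ hbk2 a
  have e0 := expGrowth_interpZ_rpow (c := c) hu hb hμ hC hθ ha
  refine integral_coord_mul_stdGaussian_eq k (fun g => ?_) (by fun_prop) (by fun_prop)
    (e0.mul e1) ?_
  · have hZ := interpZ_pos (c := c) hu hb hμ a g
    have d0 := hasDerivAt_interpInt_coord (c := c) (D := 1) (φ := fun _ => 1) hu hb
      measurable_const (by simp) a g k
    have d1 := hasDerivAt_interpInt_coord (c := c) hu hb (hu k) hbk a g k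
    simp only [one_mul] at d0
    have hZ' : interpInt μ u c (fun _ => 1) a (Function.update g k (g k)) ≠ 0 := by
      rw [Function.update_eq_self]; exact hZ.ne'
    have d := (d0.rpow_const (p := θ) (Or.inl hZ')).mul (d1.div d0 hZ')
    refine d.congr_deriv ?_
    simp only [Function.update_eq_self, interpMean, Pi.div_apply]
    rw [Real.rpow_sub hZ, Real.rpow_one]
    simp only [← pow_two]
    change 0 < interpInt μ u c (fun _ => 1) a g at hZ
    simp only [interpZ]
    field_simp
    ring
  · refine (ExpGrowth.const (a k)).mul (e0.mul ?_)
    have := e2.add ((ExpGrowth.const (-(1 - θ))).mul (e1.mul e1))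
    refine this.mono fun g => le_of_eq ?_
    congr 1
    ring

lemma interpInt_affine (hu : ∀ k, Measurable (u k)) (hb : ∀ᵐ x ∂μ, ∀ k, |u k x| ≤ C)
    (a g : ι → ℝ) (k : ι) :
    interpInt μ u c (fun x => c k * u k x - u k x ^ 2 / 2) a g =
      c k * interpInt μ u c (u k) a g - interpInt μ u c (fun x => u k x ^ 2) a g / 2 := by
  have hbk : ∀ᵐ x ∂μ, |u k x| ≤ C := hb.mono fun x hx => hx k
  have hbk2 : ∀ᵐ x ∂μ, |u k x ^ 2| ≤ C ^ 2 := hbk.mono fun x hx => by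
    rw [abs_pow]; gcongr
  have i1 := integrable_mul_exp_sum (measurable_interpStat (c := c) hu) (interpStat_bdd hb)
    (hu k) hbk (interpParam a g)
  have i2 := integrable_mul_exp_sum (measurable_interpStat (c := c) hu) (interpStat_bdd hb)
    ((hu k).pow_const 2) hbk2 (interpParam a g)
  simp only [interpInt, expInt]
  rw [← integral_const_mul, ← integral_div, ← integral_sub (i1.const_mul _) (i2.div_const _)]
  congr 1
  ext x
  ring

/-- The derivative of the fractional moment of the partition function along the interpolation. -/
theorem hasDerivAt_integral_interpZ_rpow (hu : ∀ k, Measurable (u k))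
    (hb : ∀ᵐ x ∂μ, ∀ k, |u k x| ≤ C) (hμ : μ ≠ 0) (hC : 0 ≤ C) (hθ : 0 ≤ θ)
    {a a' : ℝ → ι → ℝ} (ha : ∀ s k, HasDerivAt (fun s => a s k) (a' s k) s)
    (ha1 : ∀ s k, |a s k| ≤ 1) (ha1' : ∀ s k, |a' s k| ≤ 1) (s : ℝ) :
    HasDerivAt (fun s => ∫ g, interpZ μ u c (a s) g ^ θ ∂(stdGaussian ι))
      (∫ g, interpZ μ u c (a s) g ^ θ * (θ * ∑ k, a' s k * a s k *
        (2 * c k * interpMean μ u c (u k) (a s) g -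
          (1 - θ) * interpMean μ u c (u k) (a s) g ^ 2)) ∂(stdGaussian ι)) s := by
  set W : ℝ := C + (∑ k, |c k|) * C + C ^ 2 / 2 with hW
  have hbk : ∀ k, ∀ᵐ x ∂μ, |u k x| ≤ C := fun k => hb.mono fun x hx => hx k
  have hbk2 : ∀ k, ∀ᵐ x ∂μ, |u k x ^ 2| ≤ C ^ 2 := fun k => (hbk k).mono fun x hx => by
    rw [abs_pow]; gcongr
  have hum2 : ∀ k, Measurable fun x => u k x ^ 2 := fun k => (hu k).pow_const 2
  set w : ι → X → ℝ := fun k x => c k * u k x - u k x ^ 2 / 2 with hw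
  have hwm : ∀ k, Measurable (w k) := fun k => measurable_interpStat (c := c) hu (Sum.inr k)
  have hwb : ∀ k, ∀ᵐ x ∂μ, |w k x| ≤ W := fun k =>
    (interpStat_bdd (c := c) hb).mono fun x hx => hx (Sum.inr k)
  have c0 := fun a => continuous_interpZ_rpow (c := c) hu hb hμ a θ
  have c1 := fun a k => continuous_interpMean (c := c) hu hb hμ (hu k) (hbk k) a
  have c2 := fun a k => continuous_interpMean (c := c) hu hb hμ (hum2 k) (hbk2 k) a
  have c3 := fun a k => continuous_interpMean (c := c) hu hb hμ (hwm k) (hwb k) a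
  have e0 := fun s => expGrowth_interpZ_rpow (c := c) hu hb hμ hC hθ (ha1 s)
  have e1 := fun a k => expGrowth_interpMean (c := c) hu hb hμ (hbk k) a
  have e2 := fun a k => expGrowth_interpMean (c := c) hu hb hμ (hbk2 k) a
  obtain ⟨A, K, hA, hK, H⟩ := exists_interpZ_rpow_le (c := c) hb hC hθ hu hμ
  have key := hasDerivAt_integral_of_dominated_loc_of_deriv_le (μ := stdGaussian ι) (x₀ := s)
    (s := Set.univ) (F := fun s g => interpZ μ u c (a s) g ^ θ)
    (F' := fun s g => interpZ μ u c (a s) g ^ θ * (θ * ∑ k,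
      (a' s k * g k * interpMean μ u c (u k) (a s) g +
        2 * a s k * a' s k * interpMean μ u c (w k) (a s) g)))
    (bound := fun g => (A * Real.exp (K * ∑ k, |g k|)) * (θ * ∑ k, (|g k| * C + 2 * W)))
    Filter.univ_mem
    (Filter.Eventually.of_forall fun s => (c0 (a s)).aestronglyMeasurable)
    ((e0 s).integrable (c0 (a s)).aestronglyMeasurable)
    (Continuous.aestronglyMeasurable (by have := c0 (a s); have := c1 (a s); have := c3 (a s); 
                                         fun_prop))
    (Filter.Eventually.of_forall fun g s _ => ?_) ?_
    (Filter.Eventually.of_forall fun g s _ => ?_)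
  · refine key.2.congr_deriv ?_
    have ibp := fun k => integral_coord_mul_interpMean (c := c) hu hb hμ hC hθ (ha1 s) k
    have hN : ∀ k g, interpMean μ u c (w k) (a s) g = c k * interpMean μ u c (u k) (a s) g -
        interpMean μ u c (fun x => u k x ^ 2) (a s) g / 2 := fun k g => by
      simp only [interpMean, hw]
      rw [interpInt_affine hu hb]
      ring
    have i1 : ∀ k, Integrable (fun g => θ * a' s k *
        (g k * (interpZ μ u c (a s) g ^ θ * interpMean μ u c (u k) (a s) g))) (stdGaussian ι) :=
      fun k => (((ExpGrowth.coord k).mul ((e0 s).mul (e1 (a s) k))).integrable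
        (Continuous.aestronglyMeasurable (by
          have := c0 (a s); have := c1 (a s); fun_prop))).const_mul _
    have i2 : ∀ k, Integrable (fun g => θ * a' s k * (a s k * (interpZ μ u c (a s) g ^ θ *
        (interpMean μ u c (fun x => u k x ^ 2) (a s) g -
        (1 - θ) * interpMean μ u c (u k) (a s) g ^ 2)))) (stdGaussian ι) := fun k => by
      refine Integrable.const_mul (Integrable.const_mul (ExpGrowth.integrable ((e0 s).mul ?_)
        (Continuous.aestronglyMeasurable (by
          have := c0 (a s); have := c1 (a s); have := c2 (a s); fun_prop))) _) _
      have := (e2 (a s) k).add ((ExpGrowth.const (-(1 - θ))).mul ((e1 (a s) k).mul (e1 (a s) k)))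
      refine this.mono fun g => le_of_eq ?_
      congr 1
      ring
    have i3 : ∀ k, Integrable (fun g => interpZ μ u c (a s) g ^ θ * (θ * (2 * a s k * a' s k *
        interpMean μ u c (w k) (a s) g))) (stdGaussian ι) := fun k => by
      have hw3 := expGrowth_interpMean (c := c) hu hb hμ (hwb k) (a s)
      exact ((e0 s).mul ((ExpGrowth.const θ).mul
        ((ExpGrowth.const (2 * a s k * a' s k)).mul hw3))).integrable
          (Continuous.aestronglyMeasurable (by have := c0 (a s); have := c3 (a s); fun_prop))
    calc _ = ∫ g, ∑ k, (θ * a' s k *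
          (g k * (interpZ μ u c (a s) g ^ θ * interpMean μ u c (u k) (a s) g)) +
          interpZ μ u c (a s) g ^ θ * (θ * (2 * a s k * a' s k *
            interpMean μ u c (w k) (a s) g))) ∂(stdGaussian ι) := by
          congr 1; ext g
          rw [Finset.mul_sum, Finset.mul_sum]
          exact Finset.sum_congr rfl fun k _ => by ring
      _ = ∑ k, (∫ g, θ * a' s k * (a s k * (interpZ μ u c (a s) g ^ θ *
          (interpMean μ u c (fun x => u k x ^ 2) (a s) g -
          (1 - θ) * interpMean μ u c (u k) (a s) g ^ 2))) ∂(stdGaussian ι) +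
          ∫ g, interpZ μ u c (a s) g ^ θ * (θ * (2 * a s k * a' s k *
            interpMean μ u c (w k) (a s) g)) ∂(stdGaussian ι)) := by
          refine (integral_finsetSum _ fun k _ => (i1 k).add (i3 k)).trans ?_
          refine Finset.sum_congr rfl fun k _ => ?_
          refine (integral_add (i1 k) (i3 k)).trans ?_
          rw [integral_const_mul, ibp k, ← integral_const_mul]
      _ = ∫ g, ∑ k, (θ * a' s k * (a s k * (interpZ μ u c (a s) g ^ θ *
          (interpMean μ u c (fun x => u k x ^ 2) (a s) g -
          (1 - θ) * interpMean μ u c (u k) (a s) g ^ 2))) +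
          interpZ μ u c (a s) g ^ θ * (θ * (2 * a s k * a' s k *
            interpMean μ u c (w k) (a s) g))) ∂(stdGaussian ι) := by
          refine Eq.trans ?_ (integral_finsetSum _ fun k _ => (i2 k).add (i3 k)).symm
          exact Finset.sum_congr rfl fun k _ => (integral_add (i2 k) (i3 k)).symm
      _ = _ := by
          congr 1; ext g
          rw [Finset.mul_sum, Finset.mul_sum]
          refine Finset.sum_congr rfl fun k _ => ?_
          rw [hN]
          ring
  · have hZ := interpZ_pos (c := c) hu hb hμ (a s) g
    rw [norm_mul, Real.norm_eq_abs, Real.norm_eq_abs, abs_mul, abs_of_nonneg hθ,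
      abs_of_nonneg (Real.rpow_nonneg hZ.le θ)]
    refine mul_le_mul (H _ (ha1 s) g) (mul_le_mul_of_nonneg_left ?_ hθ) (by positivity)
      (by positivity)
    refine (Finset.abs_sum_le_sum_abs _ _).trans (Finset.sum_le_sum fun k _ => ?_)
    refine (abs_add_le _ _).trans (add_le_add ?_ ?_)
    · rw [abs_mul, abs_mul]
      have := abs_interpMean_le (c := c) hu hb hμ (hbk k) (a s) g
      refine mul_le_mul ?_ this (abs_nonneg _) (abs_nonneg _)
      exact mul_le_of_le_one_left (abs_nonneg _) (ha1' s k)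
    · rw [abs_mul, abs_mul, abs_mul, abs_two]
      have := abs_interpMean_le (c := c) hu hb hμ (hwb k) (a s) g
      refine mul_le_mul ?_ this (abs_nonneg _) (by norm_num)
      have h1 := mul_le_one₀ (ha1 s k) (abs_nonneg _) (ha1' s k)
      linarith
  · refine ExpGrowth.integrable ?_ (Continuous.aestronglyMeasurable (by fun_prop))
    refine ExpGrowth.mul ⟨A, K, hA, hK, fun g => (abs_of_nonneg (by positivity)).le⟩
      ((ExpGrowth.const θ).mul (ExpGrowth.sum _ fun k _ => ExpGrowth.add ?_ (ExpGrowth.const _)))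
    exact ExpGrowth.mul ((ExpGrowth.coord k).mono fun g => (abs_abs _).le) (ExpGrowth.const C)
  · have hZ := interpZ_pos (c := c) hu hb hμ (a s) g
    have d0 := hasDerivAt_interpInt_time (c := c) (D := 1) (φ := fun _ => 1) hu hb
      measurable_const (by simp) (fun k => ha s k) g
    simp only [one_mul] at d0
    refine (d0.rpow_const (p := θ) (Or.inl hZ.ne')).congr_deriv ?_
    rw [Real.rpow_sub hZ, Real.rpow_one]
    simp only [interpMean, Finset.mul_sum, Finset.sum_mul, hw]
    refine Finset.sum_congr rfl fun k _ => ?_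
    field_simp

end InterpolationDerivative

lemma two_mul_sum_pairs {N : ℕ} (f : Fin N → Fin N → ℝ) (hf : ∀ i j, f i j = f j i) :
    2 * ∑ p : Pairs N, f p.1.1 p.1.2 = ∑ i, ∑ j, f i j - ∑ i, f i i := by
  have h1 : ∑ p : Pairs N, f p.1.1 p.1.2 = ∑ i, ∑ j, if i < j then f i j else 0 := by
    rw [← Fintype.sum_prod_type' (f := fun i j => if i < j then f i j else 0),
      ← Finset.sum_filter]
    exact (Finset.sum_subtype (Finset.univ.filter fun p : Fin N × Fin N => p.1 < p.2)
      (by simp) (fun p => f p.1 p.2)).symm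
  have h2 : ∑ p : Pairs N, f p.1.1 p.1.2 = ∑ i, ∑ j, if j < i then f i j else 0 := by
    rw [h1, Finset.sum_comm]
    exact Finset.sum_congr rfl fun i _ => Finset.sum_congr rfl fun j _ => by rw [hf]
  have h3 : ∑ i, f i i = ∑ i, ∑ j, if i = j then f i j else 0 := by simp
  rw [two_mul]
  nth_rw 1 [h1]
  rw [h2, h3, ← Finset.sum_add_distrib, ← Finset.sum_sub_distrib]
  refine Finset.sum_congr rfl fun i _ => ?_
  rw [← Finset.sum_add_distrib, ← Finset.sum_sub_distrib]
  refine Finset.sum_congr rfl fun j _ => ?_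
  rcases lt_trichotomy i j with h | h | h
  · simp [h, h.ne, h.not_gt]
  · simp [h]
  · simp [h, h.ne', h.not_gt]

section OverlapBound

variable {N : ℕ} {ν : Measure (Fin N → ℝ)} [IsProbabilityMeasure ν] {B : ℝ}

lemma integrable_coord_mul (hB : ∀ᵐ x ∂ν, ∀ i, |x i| ≤ B) (i j : Fin N) :
    Integrable (fun x => x i * x j) ν := by
  refine Integrable.mono' (integrable_const (B * B)) (by fun_prop) ?_
  filter_upwards [hB] with x hx
  rw [norm_mul, Real.norm_eq_abs, Real.norm_eq_abs]
  exact mul_le_mul (hx i) (hx j) (abs_nonneg _) ((abs_nonneg _).trans (hx i))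

lemma integrable_coord (hB : ∀ᵐ x ∂ν, ∀ i, |x i| ≤ B) (i : Fin N) :
    Integrable (fun x => x i) ν := by
  refine Integrable.mono' (integrable_const B) (measurable_pi_apply i).aestronglyMeasurable ?_
  filter_upwards [hB] with x hx
  exact hx i

lemma integral_sub_const_sq {f : (Fin N → ℝ) → ℝ} (hf : Integrable f ν)
    (hf2 : Integrable (fun x => f x ^ 2) ν) (c : ℝ) :
    ∫ x, (f x - c) ^ 2 ∂ν = ∫ x, f x ^ 2 ∂ν - 2 * c * ∫ x, f x ∂ν + c ^ 2 := by
  have : (fun x => (f x - c) ^ 2) =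
      ((fun x => f x ^ 2) - fun x => 2 * c * f x) + fun _ => c ^ 2 := by
    ext x
    simp only [Pi.add_apply, Pi.sub_apply]
    ring
  rw [this, integral_add' (hf2.sub (hf.const_mul _)) (integrable_const _),
    integral_sub' hf2 (hf.const_mul _), integral_const_mul]
  simp

lemma sq_sum_mul (x w : Fin N → ℝ) :
    (∑ i, w i * x i) ^ 2 = ∑ i, ∑ j, w i * w j * (x i * x j) := by
  rw [pow_two, Finset.sum_mul_sum]
  exact Finset.sum_congr rfl fun i _ => Finset.sum_congr rfl fun j _ => by ring

lemma integrable_sq_sum_mul (hB : ∀ᵐ x ∂ν, ∀ i, |x i| ≤ B) (w : Fin N → ℝ) :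
    Integrable (fun x => (∑ i, w i * x i) ^ 2) ν := by
  simp only [sq_sum_mul]
  exact integrable_finsetSum _ fun i _ => integrable_finsetSum _ fun j _ =>
    (integrable_coord_mul hB i j).const_mul _

lemma integral_sq_sum_mul (hB : ∀ᵐ x ∂ν, ∀ i, |x i| ≤ B) (w : Fin N → ℝ) :
    ∫ x, (∑ i, w i * x i) ^ 2 ∂ν = ∑ i, ∑ j, w i * w j * ∫ x, x i * x j ∂ν := by
  simp only [sq_sum_mul]
  rw [integral_finsetSum _ fun i _ => integrable_finsetSum _ fun j _ =>
    (integrable_coord_mul hB i j).const_mul _]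
  refine Finset.sum_congr rfl fun i _ => ?_
  rw [integral_finsetSum _ fun j _ => (integrable_coord_mul hB i j).const_mul _]
  exact Finset.sum_congr rfl fun j _ => integral_const_mul _ _

lemma integral_sum_mul (hB : ∀ᵐ x ∂ν, ∀ i, |x i| ≤ B) (w : Fin N → ℝ) :
    ∫ x, ∑ i, w i * x i ∂ν = ∑ i, w i * ∫ x, x i ∂ν := by
  rw [integral_finsetSum _ fun i _ => (integrable_coord hB i).const_mul _]
  exact Finset.sum_congr rfl fun i _ => integral_const_mul _ _

/-- The squared Frobenius norm of the second-moment matrix dominates the fourth power of the norm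
of the mean. -/
lemma sq_sum_sq_mean_le (hB : ∀ᵐ x ∂ν, ∀ i, |x i| ≤ B) :
    (∑ i, (∫ x, x i ∂ν) ^ 2) ^ 2 ≤ ∑ i, ∑ j, (∫ x, x i * x j ∂ν) ^ 2 := by
  set p : Fin N → ℝ := fun i => ∫ x, x i ∂ν with hp
  have hint : Integrable (fun x => ∑ i, p i * x i) ν :=
    integrable_finsetSum _ fun i _ => (integrable_coord hB i).const_mul _
  have h1 : (∑ i, p i ^ 2) ^ 2 ≤ ∑ i, ∑ j, p i * p j * ∫ x, x i * x j ∂ν := by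
    rw [← integral_sq_sum_mul hB p]
    have h2 : ∑ i, p i ^ 2 = ∫ x, ∑ i, p i * x i ∂ν := by
      rw [integral_sum_mul hB]
      exact Finset.sum_congr rfl fun i _ => pow_two _
    have h3 : 0 ≤ ∫ x, (∑ i, p i * x i - ∑ i, p i ^ 2) ^ 2 ∂ν :=
      integral_nonneg fun _ => sq_nonneg _
    rw [integral_sub_const_sq hint (integrable_sq_sum_mul hB p), ← h2] at h3
    linarith
  have h5 : (∑ i, p i ^ 2) ^ 2 = ∑ i, ∑ j, p i ^ 2 * p j ^ 2 := by
    rw [pow_two, Finset.sum_mul_sum]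
  have h6 : 2 * (∑ i, ∑ j, p i * p j * ∫ x, x i * x j ∂ν) - ∑ i, ∑ j, p i ^ 2 * p j ^ 2 ≤
      ∑ i, ∑ j, (∫ x, x i * x j ∂ν) ^ 2 := by
    rw [Finset.mul_sum, ← Finset.sum_sub_distrib]
    refine Finset.sum_le_sum fun i _ => ?_
    rw [Finset.mul_sum, ← Finset.sum_sub_distrib]
    refine Finset.sum_le_sum fun j _ => ?_
    nlinarith [sq_nonneg (∫ x, x i * x j ∂ν - p i * p j)]
  linarith

/-- The exponential rate of the interpolation at a fixed overlap. -/
noncomputable def interpRate (lam q δ B θ : ℝ) (N : ℕ) : ℝ :=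
  lam * δ ^ 2 - (1 + θ) * lam * q ^ 2 / 2 + lam * B ^ 4 / (2 * N)

lemma interpolation_derivative_bound (hN : 1 ≤ N) (hB : ∀ᵐ x ∂ν, ∀ i, |x i| ≤ B)
    {lam q δ θ σ : ℝ} (hlam : 0 ≤ lam) (hq : 0 ≤ q) (hθ : 0 ≤ θ) (hθ1 : θ ≤ 1) (hσ : σ ^ 2 = 1)
    (xs : Fin N → ℝ) (hR : ∀ᵐ x ∂ν, |overlap x xs - σ * q| ≤ δ) :
    ∑ p : Pairs N, (2 * (Real.sqrt (lam / N) * xs p.1.1 * xs p.1.2) *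
        (∫ x, Real.sqrt (lam / N) * x p.1.1 * x p.1.2 ∂ν) -
        (1 - θ) * (∫ x, Real.sqrt (lam / N) * x p.1.1 * x p.1.2 ∂ν) ^ 2) -
      ∑ i, (2 * (σ * Real.sqrt (lam * q) * xs i) * (∫ x, Real.sqrt (lam * q) * x i ∂ν) -
        (1 - θ) * (∫ x, Real.sqrt (lam * q) * x i ∂ν) ^ 2) ≤
      N * interpRate lam q δ B θ N := by
  have hN0 : (0 : ℝ) < N := by exact_mod_cast hN
  set e : Fin N → Fin N → ℝ := fun i j => ∫ x, x i * x j ∂ν with he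
  set p : Fin N → ℝ := fun i => ∫ x, x i ∂ν with hp
  set n : ℝ := ∑ i, p i ^ 2 with hn
  have s1 : Real.sqrt (lam / N) ^ 2 = lam / N := Real.sq_sqrt (by positivity)
  have s2 : Real.sqrt (lam * q) ^ 2 = lam * q := Real.sq_sqrt (by positivity)
  have m1 : ∀ i j, ∫ x, Real.sqrt (lam / N) * x i * x j ∂ν = Real.sqrt (lam / N) * e i j :=
    fun i j => by
      rw [he, ← integral_const_mul]
      simp only [mul_assoc]
  have m2 : ∀ i, ∫ x, Real.sqrt (lam * q) * x i ∂ν = Real.sqrt (lam * q) * p i :=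
    fun i => integral_const_mul _ _
  have esymm : ∀ i j, e i j = e j i := fun i j => by simp only [he, mul_comm]
  have c1 := two_mul_sum_pairs (fun i j => xs i * xs j * e i j)
    (fun i j => by simp only [esymm i j]; ring)
  have c2 := two_mul_sum_pairs (fun i j => e i j ^ 2) (fun i j => by simp only [esymm i j])
  have d0 : ∀ i, 0 ≤ e i i := fun i => integral_nonneg fun x => mul_self_nonneg _
  have d1 : 0 ≤ ∑ i, xs i * xs i * e i i :=
    Finset.sum_nonneg fun i _ => mul_nonneg (mul_self_nonneg _) (d0 i)
  have d2 : ∑ i, e i i ^ 2 ≤ N * B ^ 4 := by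
    have : ∀ i ∈ Finset.univ, e i i ^ 2 ≤ B ^ 4 := fun i _ => by
      have h : e i i ≤ B ^ 2 := by
        have : e i i ≤ ∫ _, B ^ 2 ∂ν := by
          refine integral_mono_ae (integrable_coord_mul hB i i) (integrable_const _) ?_
          filter_upwards [hB] with x hx
          have := sq_le_sq' (neg_le_of_abs_le (hx i)) (le_of_abs_le (hx i))
          simpa [pow_two] using this
        simpa using this
      calc e i i ^ 2 ≤ (B ^ 2) ^ 2 := pow_le_pow_left₀ (d0 i) h 2
        _ = B ^ 4 := by ring
    simpa using Finset.sum_le_sum this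
  have d3 : n ^ 2 ≤ ∑ i, ∑ j, e i j ^ 2 := sq_sum_sq_mean_le hB
  have r1 : ∑ i, ∑ j, xs i * xs j * e i j = N ^ 2 * ∫ x, overlap x xs ^ 2 ∂ν := by
    rw [← integral_sq_sum_mul hB xs, ← integral_const_mul]
    congr 1; ext x
    simp only [overlap, mul_comm (x _)]
    field_simp
  have r2 : ∑ i, xs i * p i = N * ∫ x, overlap x xs ∂ν := by
    rw [← integral_sum_mul hB xs, ← integral_const_mul]
    congr 1; ext x
    simp only [overlap, mul_comm (x _)]
    field_simp
  have iR2 : Integrable (fun x => overlap x xs ^ 2) ν := by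
    have := (integrable_sq_sum_mul hB xs).const_mul ((1 / (N : ℝ)) ^ 2)
    refine this.congr (Filter.Eventually.of_forall fun x => ?_)
    simp only [overlap, mul_comm (x _), mul_pow]
  have iR : Integrable (fun x => overlap x xs) ν := by
    have : Integrable (fun x => ∑ i, xs i * x i) ν :=
      integrable_finsetSum _ fun i _ => (integrable_coord hB i).const_mul _
    refine (this.const_mul (1 / (N : ℝ))).congr (Filter.Eventually.of_forall fun x => ?_)
    simp only [overlap, mul_comm (x _)]
  have r3 : ∫ x, overlap x xs ^ 2 ∂ν - 2 * σ * q * ∫ x, overlap x xs ∂ν + q ^ 2 ≤ δ ^ 2 := by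
    have h1 : ∫ x, (overlap x xs - σ * q) ^ 2 ∂ν ≤ ∫ _, δ ^ 2 ∂ν := by
      refine integral_mono_of_nonneg (Filter.Eventually.of_forall fun _ => sq_nonneg _)
        (integrable_const _) ?_
      filter_upwards [hR] with x hx
      exact sq_le_sq' (neg_le_of_abs_le hx) (le_of_abs_le hx)
    rw [integral_sub_const_sq iR iR2, mul_pow, hσ, one_mul, ← mul_assoc] at h1
    simpa using h1
  have t1 : ∑ p : Pairs N, (2 * (Real.sqrt (lam / N) * xs p.1.1 * xs p.1.2) *
        (∫ x, Real.sqrt (lam / N) * x p.1.1 * x p.1.2 ∂ν) -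
        (1 - θ) * (∫ x, Real.sqrt (lam / N) * x p.1.1 * x p.1.2 ∂ν) ^ 2) =
      lam / N * (2 * ∑ p : Pairs N, xs p.1.1 * xs p.1.2 * e p.1.1 p.1.2) -
        (1 - θ) * (lam / N) * ∑ p : Pairs N, e p.1.1 p.1.2 ^ 2 := by
    rw [Finset.mul_sum, Finset.mul_sum, Finset.mul_sum, ← Finset.sum_sub_distrib]
    refine Finset.sum_congr rfl fun p _ => ?_
    rw [m1]
    linear_combination (2 * xs p.1.1 * xs p.1.2 * e p.1.1 p.1.2 -
      (1 - θ) * e p.1.1 p.1.2 ^ 2) * s1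
  have t2 : ∑ i, (2 * (σ * Real.sqrt (lam * q) * xs i) * (∫ x, Real.sqrt (lam * q) * x i ∂ν) -
        (1 - θ) * (∫ x, Real.sqrt (lam * q) * x i ∂ν) ^ 2) =
      2 * σ * (lam * q) * ∑ i, xs i * p i - (1 - θ) * (lam * q) * n := by
    rw [hn, Finset.mul_sum, Finset.mul_sum, ← Finset.sum_sub_distrib]
    refine Finset.sum_congr rfl fun i _ => ?_
    rw [m2]
    linear_combination (2 * σ * xs i * p i - (1 - θ) * p i ^ 2) * s2
  rw [t1, t2, c1, r1, r2]
  have hlN : 0 ≤ lam / N := by positivity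
  have u1 : (1 - θ) * (lam / N) * ((2 * q * N * n - q ^ 2 * N ^ 2 - N * B ^ 4) / 2) ≤
      (1 - θ) * (lam / N) * ∑ p : Pairs N, e p.1.1 p.1.2 ^ 2 := by
    refine mul_le_mul_of_nonneg_left ?_ (mul_nonneg (by linarith) hlN)
    nlinarith [sq_nonneg (n - q * N)]
  have u2 : 0 ≤ lam / N * ∑ i, xs i * xs i * e i i := mul_nonneg hlN d1
  have u3 := mul_le_mul_of_nonneg_left r3 (mul_nonneg hlam hN0.le)
  have u4 : 0 ≤ θ * (lam * B ^ 4 / 2) := by positivity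
  have v1 : (1 - θ) * (lam / N) * ((2 * q * N * n - q ^ 2 * N ^ 2 - N * B ^ 4) / 2) =
      (1 - θ) * (lam * q * n - lam * q ^ 2 * N / 2 - lam * B ^ 4 / 2) := by
    field_simp
  have v2 : lam / N * (N ^ 2 * ∫ x, overlap x xs ^ 2 ∂ν - ∑ i, xs i * xs i * e i i) =
      lam * N * ∫ x, overlap x xs ^ 2 ∂ν - lam / N * ∑ i, xs i * xs i * e i i := by
    field_simp
  have v3 : N * interpRate lam q δ B θ N =
      lam * N * δ ^ 2 - (1 + θ) * lam * q ^ 2 / 2 * N + lam * B ^ 4 / 2 := by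
    rw [interpRate]
    field_simp
  rw [v1] at u1
  rw [v2, v3]
  linarith

end OverlapBound

lemma interpMean_eq_integral_tilted {X ι : Type*} [MeasurableSpace X] [Fintype ι]
    (μ : Measure X) (u : ι → X → ℝ) (c : ι → ℝ) (φ : X → ℝ) (a g : ι → ℝ) :
    interpMean μ u c φ a g =
      ∫ x, φ x ∂(μ.tilted fun x => ∑ j, interpParam a g j * interpStat u c j x) := by
  rw [integral_tilted]
  simp only [interpMean, interpZ, interpInt, expInt, one_mul, smul_eq_mul]
  rw [← integral_div]
  congr 1
  ext x
  ring

/-- Interaction statistics on pairs, and field statistics on sites. -/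
noncomputable def spikeStat (lam q : ℝ) (N : ℕ) : Pairs N ⊕ Fin N → (Fin N → ℝ) → ℝ :=
  Sum.elim (fun p x => Real.sqrt (lam / N) * x p.1.1 * x p.1.2)
    fun i x => Real.sqrt (lam * q) * x i

/-- The planted drifts; the sign `σ` flips the fields. -/
noncomputable def spikeDrift (lam q σ : ℝ) {N : ℕ} (xs : Fin N → ℝ) : Pairs N ⊕ Fin N → ℝ :=
  Sum.elim (fun p => Real.sqrt (lam / N) * xs p.1.1 * xs p.1.2)
    fun i => σ * Real.sqrt (lam * q) * xs i

/-- The trigonometric interpolation path from the fields to the interactions. -/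
noncomputable def spikePath (N : ℕ) (s : ℝ) : Pairs N ⊕ Fin N → ℝ :=
  Sum.elim (fun _ => Real.sin s) fun _ => Real.cos s

/-- The velocity of `spikePath`. -/
noncomputable def spikePathDeriv (N : ℕ) (s : ℝ) : Pairs N ⊕ Fin N → ℝ :=
  Sum.elim (fun _ => Real.cos s) fun _ => -Real.sin s

lemma hasDerivAt_spikePath (N : ℕ) (s : ℝ) (k : Pairs N ⊕ Fin N) :
    HasDerivAt (fun s => spikePath N s k) (spikePathDeriv N s k) s := by
  rcases k with k | k
  · exact Real.hasDerivAt_sin s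
  · exact Real.hasDerivAt_cos s

lemma abs_spikePath_le (N : ℕ) (s : ℝ) (k : Pairs N ⊕ Fin N) : |spikePath N s k| ≤ 1 := by
  rcases k with k | k
  · exact Real.abs_sin_le_one s
  · exact Real.abs_cos_le_one s

lemma abs_spikePathDeriv_le (N : ℕ) (s : ℝ) (k : Pairs N ⊕ Fin N) :
    |spikePathDeriv N s k| ≤ 1 := by
  rcases k with k | k
  · exact Real.abs_cos_le_one s
  · simpa [spikePathDeriv] using Real.abs_sin_le_one s

lemma measurable_spikeStat (lam q : ℝ) (N : ℕ) (k : Pairs N ⊕ Fin N) :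
    Measurable (spikeStat lam q N k) := by
  rcases k with p | i
  · simp only [spikeStat, Sum.elim_inl]; fun_prop
  · simp only [spikeStat, Sum.elim_inr]; fun_prop

lemma abs_spikeStat_le {lam q B : ℝ} {N : ℕ} {x : Fin N → ℝ} (hx : ∀ i, |x i| ≤ B)
    (k : Pairs N ⊕ Fin N) :
    |spikeStat lam q N k x| ≤ Real.sqrt (lam / N) * |B| * |B| + Real.sqrt (lam * q) * |B| := by
  have hx' : ∀ i, |x i| ≤ |B| := fun i => (hx i).trans (le_abs_self B)
  rcases k with p | i
  · have h1 : |spikeStat lam q N (Sum.inl p) x| ≤ Real.sqrt (lam / N) * |B| * |B| := by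
      simp only [spikeStat, Sum.elim_inl]
      rw [abs_mul, abs_mul, abs_of_nonneg (Real.sqrt_nonneg _)]
      exact mul_le_mul (mul_le_mul_of_nonneg_left (hx' _) (Real.sqrt_nonneg _)) (hx' _)
        (abs_nonneg _) (by positivity)
    have h2 : 0 ≤ Real.sqrt (lam * q) * |B| := by positivity
    linarith
  · have h1 : |spikeStat lam q N (Sum.inr i) x| ≤ Real.sqrt (lam * q) * |B| := by
      simp only [spikeStat, Sum.elim_inr]
      rw [abs_mul, abs_of_nonneg (Real.sqrt_nonneg _)]
      exact mul_le_mul_of_nonneg_left (hx' _) (Real.sqrt_nonneg _)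
    have h2 : 0 ≤ Real.sqrt (lam / N) * |B| * |B| := by positivity
    linarith

/-- Comparison of the two ends of the interpolation, at a fixed overlap with a fixed spike. -/
theorem integral_interpZ_rpow_le {N : ℕ} (hN : 1 ≤ N) {μ : Measure (Fin N → ℝ)}
    [IsFiniteMeasure μ] {B : ℝ} (hB : ∀ᵐ x ∂μ, ∀ i, |x i| ≤ B)
    {lam q δ θ σ : ℝ} (hlam : 0 ≤ lam) (hq : 0 ≤ q) (hθ : 0 < θ) (hθ1 : θ ≤ 1) (hσ : σ ^ 2 = 1)
    (xs : Fin N → ℝ) (hR : ∀ᵐ x ∂μ, |overlap x xs - σ * q| ≤ δ) :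
    ∫ g, interpZ μ (spikeStat lam q N) (spikeDrift lam q σ xs) (spikePath N (Real.pi / 2)) g ^ θ
        ∂(stdGaussian (Pairs N ⊕ Fin N)) ≤
      Real.exp (θ * N * interpRate lam q δ B θ N / 2) *
        ∫ g, interpZ μ (spikeStat lam q N) (spikeDrift lam q σ xs) (spikePath N 0) g ^ θ
          ∂(stdGaussian (Pairs N ⊕ Fin N)) := by
  by_cases hμ : μ = 0
  · subst hμ
    simp [interpZ, interpInt, expInt, Real.zero_rpow hθ.ne']
  have : NeZero μ := ⟨hμ⟩
  set D := interpRate lam q δ B θ N with hD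
  set u := spikeStat lam q N with hu_def
  set c := spikeDrift lam q σ xs with hc_def
  set C := Real.sqrt (lam / N) * |B| * |B| + Real.sqrt (lam * q) * |B| with hC_def
  have hC : 0 ≤ C := by positivity
  have hu : ∀ k, Measurable (u k) := measurable_spikeStat lam q N
  have hb : ∀ᵐ x ∂μ, ∀ k, |u k x| ≤ C := hB.mono fun x hx k => abs_spikeStat_le hx k
  have hbk : ∀ k, ∀ᵐ x ∂μ, |u k x| ≤ C := fun k => hb.mono fun x hx => hx k
  set G : ℝ → ℝ := fun s => ∫ g, interpZ μ u c (spikePath N s) g ^ θ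
    ∂(stdGaussian (Pairs N ⊕ Fin N)) with hG
  have hder := fun s => hasDerivAt_integral_interpZ_rpow (c := c) hu hb hμ hC hθ.le
    (a := spikePath N) (a' := spikePathDeriv N) (hasDerivAt_spikePath N)
    (abs_spikePath_le N) (abs_spikePathDeriv_le N) s
  set G' : ℝ → ℝ := fun s => ∫ g, interpZ μ u c (spikePath N s) g ^ θ * (θ * ∑ k,
    spikePathDeriv N s k * spikePath N s k * (2 * c k * interpMean μ u c (u k) (spikePath N s) g -
      (1 - θ) * interpMean μ u c (u k) (spikePath N s) g ^ 2))
        ∂(stdGaussian (Pairs N ⊕ Fin N)) with hG'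
  have hle : ∀ s ∈ Set.Icc 0 (Real.pi / 2),
      G' s ≤ θ * N * D * (Real.sin s * Real.cos s) * G s := by
    intro s hs
    have hsin : 0 ≤ Real.sin s :=
      Real.sin_nonneg_of_nonneg_of_le_pi hs.1 (hs.2.trans (by linarith [Real.pi_pos]))
    have hcos : 0 ≤ Real.cos s :=
      Real.cos_nonneg_of_neg_pi_div_two_le_of_le (by linarith [Real.pi_pos, hs.1]) hs.2
    have c0 := continuous_interpZ_rpow (c := c) hu hb hμ (spikePath N s) θ
    have e0 := expGrowth_interpZ_rpow (c := c) hu hb hμ hC hθ.le (abs_spikePath_le N s)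
    have c1 := fun k => continuous_interpMean (c := c) hu hb hμ (hu k) (hbk k) (spikePath N s)
    have e1 := fun k => expGrowth_interpMean (c := c) hu hb hμ (hbk k) (spikePath N s)
    simp only [hG', hG]
    rw [← integral_const_mul]
    refine integral_mono ?_ ((e0.integrable c0.aestronglyMeasurable).const_mul _) fun g => ?_
    · refine ExpGrowth.integrable (e0.mul ((ExpGrowth.const θ).mul
        (ExpGrowth.sum _ fun k _ => (ExpGrowth.const _).mul ?_)))
        (Continuous.aestronglyMeasurable (by fun_prop))
      refine (((ExpGrowth.const (2 * c k)).mul (e1 k)).add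
        ((ExpGrowth.const (-(1 - θ))).mul ((e1 k).mul (e1 k)))).mono fun g => le_of_eq ?_
      congr 1
      ring
    · have hZ := interpZ_pos (c := c) hu hb hμ (spikePath N s) g
      have hi := integrable_mul_exp_sum (φ := fun _ => 1) (D := 1)
        (measurable_interpStat (c := c) hu) (interpStat_bdd hb) measurable_const (by simp)
        (interpParam (spikePath N s) g)
      simp only [one_mul] at hi
      have hprob := isProbabilityMeasure_tilted hi
      have hac := tilted_absolutelyContinuous μ
        (fun x => ∑ j, interpParam (spikePath N s) g j * interpStat u c j x)
      have key := interpolation_derivative_bound hN (hac.ae_le hB) hlam hq hθ.le hθ1 hσ xs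
        (hac.ae_le hR)
      have hsum : ∑ k, spikePathDeriv N s k * spikePath N s k *
          (2 * c k * interpMean μ u c (u k) (spikePath N s) g -
            (1 - θ) * interpMean μ u c (u k) (spikePath N s) g ^ 2) ≤
          Real.sin s * Real.cos s * (N * D) := by
        refine le_trans (le_of_eq ?_) (mul_le_mul_of_nonneg_left key (mul_nonneg hsin hcos))
        rw [Fintype.sum_sum_type, mul_sub, Finset.mul_sum, Finset.mul_sum,
          sub_eq_add_neg (Finset.sum _ _) (Finset.sum _ _), ← Finset.sum_neg_distrib]
        simp only [interpMean_eq_integral_tilted]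
        congr 1
        · refine Finset.sum_congr rfl fun p _ => ?_
          simp only [spikePathDeriv, spikePath, hc_def, hu_def, spikeDrift, spikeStat,
            Sum.elim_inl]
          ring
        · refine Finset.sum_congr rfl fun p _ => ?_
          simp only [spikePathDeriv, spikePath, hc_def, hu_def, spikeDrift, spikeStat,
            Sum.elim_inr]
          ring
      have h0 := Real.rpow_nonneg hZ.le θ
      have := mul_le_mul_of_nonneg_left (mul_le_mul_of_nonneg_left hsum hθ.le) h0
      refine this.trans (le_of_eq ?_)
      ring
  set E : ℝ → ℝ := fun s => Real.exp (-(θ * N * D / 2 * Real.sin s ^ 2)) with hE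
  have hEd : ∀ s, HasDerivAt E (E s * -(θ * N * D * (Real.sin s * Real.cos s))) s := by
    intro s
    have h1 := (((Real.hasDerivAt_sin s).pow 2).const_mul (θ * N * D / 2)).neg.exp
    refine h1.congr_deriv ?_
    simp only [hE, Pi.pow_apply, Pi.neg_apply]
    ring
  have hd : ∀ s, HasDerivAt (fun s => E s * G s)
      (E s * -(θ * N * D * (Real.sin s * Real.cos s)) * G s + E s * G' s) s :=
    fun s => (hEd s).mul (hder s)
  have hanti : AntitoneOn (fun s => E s * G s) (Set.Icc 0 (Real.pi / 2)) := by
    refine antitoneOn_of_deriv_nonpos (convex_Icc _ _)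
      (fun s _ => (hd s).continuousAt.continuousWithinAt)
      (fun s _ => (hd s).differentiableAt.differentiableWithinAt) fun s hs => ?_
    rw [(hd s).deriv]
    have h1 := mul_le_mul_of_nonneg_left (hle s (interior_subset hs)) (Real.exp_pos
      (-(θ * N * D / 2 * Real.sin s ^ 2))).le
    simp only [hE]
    linarith
  have hpi : (0 : ℝ) ≤ Real.pi / 2 := by positivity
  have := hanti (Set.left_mem_Icc.2 hpi) (Set.right_mem_Icc.2 hpi) hpi
  simp only [hE, Real.sin_pi_div_two, Real.sin_zero] at this
  norm_num at this
  calc G (Real.pi / 2) = Real.exp (θ * N * D / 2) *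
        (Real.exp (-(θ * N * D / 2)) * G (Real.pi / 2)) := by
        rw [← mul_assoc, ← Real.exp_add]; simp
    _ ≤ _ := mul_le_mul_of_nonneg_left this (Real.exp_pos _).le

section Restriction

variable {α β : Type*} [Fintype α] [Fintype β] {X : Type*} [MeasurableSpace X]
  (μ : Measure X) [IsProbabilityMeasure μ]

lemma measurePreserving_comp_inl :
    MeasurePreserving (fun (g : α ⊕ β → X) (i : α) => g (Sum.inl i))
      (Measure.pi fun _ => μ) (Measure.pi fun _ => μ) := by
  refine ⟨by fun_prop, (Measure.pi_eq fun s hs => ?_).symm⟩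
  rw [Measure.map_apply (by fun_prop) (MeasurableSet.univ_pi hs)]
  have : (fun (g : α ⊕ β → X) (i : α) => g (Sum.inl i)) ⁻¹' (Set.univ.pi s) =
      Set.univ.pi (Sum.elim s fun _ => Set.univ) := by
    ext g
    simp
  rw [this, Measure.pi_pi, Fintype.prod_sum_type]
  simp

lemma measurePreserving_comp_inr :
    MeasurePreserving (fun (g : α ⊕ β → X) (i : β) => g (Sum.inr i))
      (Measure.pi fun _ => μ) (Measure.pi fun _ => μ) := by
  refine ⟨by fun_prop, (Measure.pi_eq fun s hs => ?_).symm⟩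
  rw [Measure.map_apply (by fun_prop) (MeasurableSet.univ_pi hs)]
  have : (fun (g : α ⊕ β → X) (i : β) => g (Sum.inr i)) ⁻¹' (Set.univ.pi s) =
      Set.univ.pi (Sum.elim (fun _ => Set.univ) s) := by
    ext g
    simp
  rw [this, Measure.pi_pi, Fintype.prod_sum_type]
  simp

end Restriction

lemma integral_comp_measurePreserving {α β : Type*} [MeasurableSpace α] [MeasurableSpace β]
    {μ : Measure α} {ν : Measure β} {f : α → β} (hf : MeasurePreserving f μ ν) {F : β → ℝ}
    (hF : AEStronglyMeasurable F ν) : ∫ a, F (f a) ∂μ = ∫ b, F b ∂ν := by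
  rw [← hf.map_eq, integral_map hf.measurable.aemeasurable (by rwa [hf.map_eq])]

/-- The partition function of the scalar channel. -/
noncomputable def siteZ (P : Measure ℝ) (r y z : ℝ) : ℝ :=
  ∫ x, Real.exp (Real.sqrt r * z * x + r * x * y - r / 2 * x ^ 2) ∂P

/-- The partition function restricted to the configurations whose overlap with `xs` is in `A`. -/
noncomputable def overlapZ {N : ℕ} (P : Measure ℝ) (lam : ℝ) (A : Set ℝ) (xs : Fin N → ℝ)
    (Y : Pairs N → ℝ) : ℝ :=
  ∫ x, {x : Fin N → ℝ | overlap x xs ∈ A}.indicator (fun _ => (1 : ℝ)) x *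
    Real.exp (negHamiltonian lam Y x) ∂(priorN P N)

instance (P : Measure ℝ) [IsProbabilityMeasure P] (N : ℕ) : IsProbabilityMeasure (priorN P N) := by
  unfold priorN
  infer_instance

instance (N : ℕ) : IsProbabilityMeasure (noiseLaw N) := by
  unfold noiseLaw
  infer_instance

lemma measurable_overlap {N : ℕ} :
    Measurable (fun p : (Fin N → ℝ) × (Fin N → ℝ) => overlap p.1 p.2) := by
  unfold overlap
  fun_prop

lemma measurable_negHamiltonian {N : ℕ} (lam : ℝ) :
    Measurable (fun p : (Pairs N → ℝ) × (Fin N → ℝ) => negHamiltonian lam p.1 p.2) := by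
  unfold negHamiltonian
  fun_prop

lemma measurable_observation {N : ℕ} (lam : ℝ) :
    Measurable (fun p : (Fin N → ℝ) × (Pairs N → ℝ) => observation lam p.1 p.2) := by
  unfold observation
  fun_prop

lemma measurableSet_overlap_mem {N : ℕ} {A : Set ℝ} (hA : MeasurableSet A) (xs : Fin N → ℝ) :
    MeasurableSet {x : Fin N → ℝ | overlap x xs ∈ A} :=
  (measurable_overlap.comp (measurable_id.prodMk measurable_const)) hA

section Prior

variable {P : Measure ℝ} [IsProbabilityMeasure P] {B : ℝ}

lemma measurable_overlapZ {N : ℕ} (lam : ℝ) {A : Set ℝ} (hA : MeasurableSet A) :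
    Measurable (fun p : (Fin N → ℝ) × (Pairs N → ℝ) => overlapZ P lam A p.1 p.2) := by
  unfold overlapZ
  refine (StronglyMeasurable.integral_prod_right (f := fun (p : (Fin N → ℝ) × (Pairs N → ℝ))
    (x : Fin N → ℝ) => {x : Fin N → ℝ | overlap x p.1 ∈ A}.indicator (fun _ => (1 : ℝ)) x *
    Real.exp (negHamiltonian lam p.2 x)) ?_).measurable
  refine Measurable.stronglyMeasurable (Measurable.mul ?_ ?_)
  · have h : MeasurableSet {q : ((Fin N → ℝ) × (Pairs N → ℝ)) × (Fin N → ℝ) |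
        overlap q.2 q.1.1 ∈ A} :=
      (measurable_overlap.comp (measurable_snd.prodMk (measurable_fst.comp measurable_fst))) hA
    exact (measurable_const (a := (1 : ℝ))).indicator h
  · exact Real.measurable_exp.comp ((measurable_negHamiltonian lam).comp
      ((measurable_snd.comp measurable_fst).prodMk measurable_snd))

lemma measurable_siteZ (r : ℝ) : Measurable (fun p : ℝ × ℝ => siteZ P r p.1 p.2) := by
  unfold siteZ
  refine (StronglyMeasurable.integral_prod_right (f := fun (p : ℝ × ℝ) (x : ℝ) =>
    Real.exp (Real.sqrt r * p.2 * x + r * x * p.1 - r / 2 * x ^ 2)) ?_).measurable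
  exact Measurable.stronglyMeasurable (by fun_prop)

lemma ae_priorN_abs_le (hB : ∀ᵐ x ∂P, |x| ≤ B) (N : ℕ) :
    ∀ᵐ x ∂(priorN P N), ∀ i, |x i| ≤ B :=
  ae_all_iff.2 fun i =>
    (measurePreserving_eval (fun _ : Fin N => P) i).quasiMeasurePreserving.ae hB

lemma abs_site_exponent_le {r x y z : ℝ} (hr : 0 ≤ r) (hx : |x| ≤ B) :
    |Real.sqrt r * z * x + r * x * y - r / 2 * x ^ 2| ≤
      Real.sqrt r * B * |z| + r * B * |y| + r / 2 * B ^ 2 := by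
  have hB0 : 0 ≤ B := (abs_nonneg x).trans hx
  refine (abs_sub _ _).trans (add_le_add ((abs_add_le _ _).trans (add_le_add ?_ ?_)) ?_)
  · rw [abs_mul, abs_mul, abs_of_nonneg (Real.sqrt_nonneg r)]
    nlinarith [mul_le_mul_of_nonneg_left hx (mul_nonneg (Real.sqrt_nonneg r) (abs_nonneg z))]
  · rw [abs_mul, abs_mul, abs_of_nonneg hr]
    nlinarith [mul_le_mul_of_nonneg_left hx (mul_nonneg hr (abs_nonneg y))]
  · rw [abs_mul, abs_pow, abs_of_nonneg (by positivity : 0 ≤ r / 2)]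
    gcongr

lemma integrable_site (hB : ∀ᵐ x ∂P, |x| ≤ B) {r : ℝ} (hr : 0 ≤ r) (y z : ℝ) :
    Integrable (fun x => Real.exp (Real.sqrt r * z * x + r * x * y - r / 2 * x ^ 2)) P := by
  refine Integrable.mono' (integrable_const (Real.exp (Real.sqrt r * B * |z| + r * B * |y| +
    r / 2 * B ^ 2))) (Measurable.aestronglyMeasurable (by fun_prop)) ?_
  filter_upwards [hB] with x hx
  rw [Real.norm_eq_abs, Real.abs_exp]
  exact Real.exp_le_exp.2 ((le_abs_self _).trans (abs_site_exponent_le hr hx))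

lemma siteZ_pos (hB : ∀ᵐ x ∂P, |x| ≤ B) {r : ℝ} (hr : 0 ≤ r) (y z : ℝ) : 0 < siteZ P r y z :=
  integral_exp_pos (integrable_site hB hr y z)

lemma abs_log_siteZ_le (hB : ∀ᵐ x ∂P, |x| ≤ B) {r : ℝ} (hr : 0 ≤ r) (y z : ℝ) :
    |Real.log (siteZ P r y z)| ≤ Real.sqrt r * B * |z| + r * B * |y| + r / 2 * B ^ 2 := by
  have hpos := siteZ_pos hB hr y z
  have hint := integrable_site hB hr y z
  rw [abs_le]
  constructor
  · rw [Real.le_log_iff_exp_le hpos]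
    have : ∫ _, Real.exp (-(Real.sqrt r * B * |z| + r * B * |y| + r / 2 * B ^ 2)) ∂P ≤
        siteZ P r y z := by
      refine integral_mono_ae (integrable_const _) hint ?_
      filter_upwards [hB] with x hx
      exact Real.exp_le_exp.2 (neg_le_of_abs_le (abs_site_exponent_le hr hx))
    simpa using this
  · rw [Real.log_le_iff_le_exp hpos]
    have : siteZ P r y z ≤
        ∫ _, Real.exp (Real.sqrt r * B * |z| + r * B * |y| + r / 2 * B ^ 2) ∂P := by
      refine integral_mono_ae hint (integrable_const _) ?_
      filter_upwards [hB] with x hx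
      exact Real.exp_le_exp.2 (le_of_abs_le (abs_site_exponent_le hr hx))
    simpa using this

lemma integrable_siteZ_rpow (hB : ∀ᵐ x ∂P, |x| ≤ B) {r : ℝ} (hr : 0 ≤ r) (y θ : ℝ) :
    Integrable (fun z => siteZ P r y z ^ θ) (gaussianReal 0 1) := by
  refine Integrable.mono' ((integrable_exp_mul_abs_gaussianReal (|θ| * (Real.sqrt r * B))).const_mul
    (Real.exp (|θ| * (r * B * |y| + r / 2 * B ^ 2))))
    (Measurable.aestronglyMeasurable
      (((measurable_siteZ r).comp (measurable_const.prodMk measurable_id)).pow_const θ)) ?_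
  refine Filter.Eventually.of_forall fun z => ?_
  have hpos := siteZ_pos hB hr y z
  rw [Real.norm_eq_abs, abs_of_nonneg (Real.rpow_nonneg hpos.le _),
    Real.rpow_def_of_pos hpos, ← Real.exp_add]
  refine Real.exp_le_exp.2 ((le_abs_self _).trans ?_)
  rw [abs_mul, mul_comm]
  have := mul_le_mul_of_nonneg_left (abs_log_siteZ_le hB hr y z) (abs_nonneg θ)
  refine this.trans (le_of_eq ?_)
  ring

lemma setIntegral_eq_overlapZ {N : ℕ} (lam : ℝ) {A : Set ℝ} (hA : MeasurableSet A)
    (xs : Fin N → ℝ) (Y : Pairs N → ℝ) :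
    ∫ x in {x : Fin N → ℝ | overlap x xs ∈ A}, Real.exp (negHamiltonian lam Y x) ∂(priorN P N) =
      overlapZ P lam A xs Y := by
  rw [overlapZ, ← integral_indicator (measurableSet_overlap_mem hA xs)]
  congr 1
  ext x
  by_cases h : x ∈ {x : Fin N → ℝ | overlap x xs ∈ A} <;> simp [h]

lemma interpZ_end {N : ℕ} {lam : ℝ} (hlam : 0 ≤ lam) (q σ : ℝ) {A : Set ℝ} (hA : MeasurableSet A)
    (xs : Fin N → ℝ) (g : Pairs N ⊕ Fin N → ℝ) :
    interpZ ((priorN P N).restrict {x | overlap x xs ∈ A}) (spikeStat lam q N)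
      (spikeDrift lam q σ xs) (spikePath N (Real.pi / 2)) g =
      overlapZ P lam A xs (observation lam xs fun p => g (Sum.inl p)) := by
  rw [interpZ, interpInt_eq, ← setIntegral_eq_overlapZ lam hA]
  congr 1
  ext x
  rw [one_mul, Fintype.sum_sum_type]
  congr 1
  simp only [spikeStat, spikeDrift, spikePath, Sum.elim_inl, Sum.elim_inr, Real.sin_pi_div_two,
    Real.cos_pi_div_two]
  simp only [negHamiltonian, observation]
  have s1 : Real.sqrt (lam / N) ^ 2 = lam / N := Real.sq_sqrt (by positivity)
  have h0 : ∀ t : Fin N → ℝ, ∑ i, ((0 : ℝ) * g (Sum.inr i) * (Real.sqrt (lam * q) * x i) +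
    0 ^ 2 * t i) = 0 := by simp
  rw [h0, add_zero]
  refine Finset.sum_congr rfl fun p _ => ?_
  have s2 : lam / (2 * N) = lam / N / 2 := by rw [div_div, mul_comm]
  rw [s2]
  linear_combination (-(x p.1.1 ^ 2 * x p.1.2 ^ 2 / 2)) * s1

lemma interpZ_start_le {N : ℕ} (hB : ∀ᵐ x ∂P, |x| ≤ B) {lam q : ℝ} (hlam : 0 ≤ lam) (hq : 0 ≤ q)
    (σ : ℝ) (S : Set (Fin N → ℝ)) (xs : Fin N → ℝ) (g : Pairs N ⊕ Fin N → ℝ) :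
    interpZ ((priorN P N).restrict S) (spikeStat lam q N) (spikeDrift lam q σ xs)
      (spikePath N 0) g ≤ ∏ i, siteZ P (lam * q) (σ * xs i) (g (Sum.inr i)) := by
  have hr : 0 ≤ lam * q := mul_nonneg hlam hq
  have s1 : Real.sqrt (lam * q) ^ 2 = lam * q := Real.sq_sqrt hr
  have e : ∀ x : Fin N → ℝ, (1 : ℝ) * Real.exp (∑ k, (spikePath N 0 k * g k * spikeStat lam q N k x +
      spikePath N 0 k ^ 2 * (spikeDrift lam q σ xs k * spikeStat lam q N k x -
        spikeStat lam q N k x ^ 2 / 2))) =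
      ∏ i, Real.exp (Real.sqrt (lam * q) * g (Sum.inr i) * x i +
        lam * q * x i * (σ * xs i) - lam * q / 2 * x i ^ 2) := by
    intro x
    rw [one_mul, Fintype.sum_sum_type, ← Real.exp_sum]
    congr 1
    simp only [spikeStat, spikeDrift, spikePath, Sum.elim_inl, Sum.elim_inr, Real.sin_zero,
      Real.cos_zero, zero_mul, ne_eq, OfNat.ofNat_ne_zero, not_false_eq_true, zero_pow, add_zero,
      Finset.sum_const_zero, zero_add]
    refine Finset.sum_congr rfl fun i _ => ?_
    linear_combination (σ * xs i * x i - x i ^ 2 / 2) * s1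
  rw [interpZ, interpInt_eq]
  simp only [e]
  have hint : Integrable (fun x : Fin N → ℝ => ∏ i, Real.exp (Real.sqrt (lam * q) *
      g (Sum.inr i) * x i + lam * q * x i * (σ * xs i) - lam * q / 2 * x i ^ 2)) (priorN P N) :=
    Integrable.fintype_prod (f := fun (i : Fin N) (t : ℝ) => Real.exp (Real.sqrt (lam * q) *
      g (Sum.inr i) * t + lam * q * t * (σ * xs i) - lam * q / 2 * t ^ 2))
      fun i => integrable_site hB hr _ _
  refine (setIntegral_le_integral hint (Filter.Eventually.of_forall fun x =>
    Finset.prod_nonneg fun _ _ => (Real.exp_pos _).le)).trans (le_of_eq ?_)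
  exact integral_fintype_prod_eq_prod (fun (i : Fin N) (t : ℝ) => Real.exp (Real.sqrt (lam * q) *
      g (Sum.inr i) * t + lam * q * t * (σ * xs i) - lam * q / 2 * t ^ 2))

lemma overlapZ_nonneg {N : ℕ} (lam : ℝ) (A : Set ℝ) (xs : Fin N → ℝ) (Y : Pairs N → ℝ) :
    0 ≤ overlapZ P lam A xs Y :=
  integral_nonneg fun _ => mul_nonneg (Set.indicator_nonneg (fun _ _ => zero_le_one) _)
    (Real.exp_pos _).le

/-- The fractional moment of the partition function at a fixed overlap is controlled by that of the
scalar channel. -/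
theorem integral_overlapZ_rpow_le {N : ℕ} (hN : 1 ≤ N) (hB : ∀ᵐ x ∂P, |x| ≤ B)
    {lam q δ θ σ : ℝ} (hlam : 0 ≤ lam) (hq : 0 ≤ q) (hθ : 0 < θ) (hθ1 : θ ≤ 1) (hσ : σ ^ 2 = 1)
    {A : Set ℝ} (hA : MeasurableSet A) (hAδ : ∀ t ∈ A, |t - σ * q| ≤ δ) (xs : Fin N → ℝ) :
    ∫ W, overlapZ P lam A xs (observation lam xs W) ^ θ ∂(noiseLaw N) ≤
      Real.exp (θ * N * interpRate lam q δ B θ N / 2) *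
        ∏ i, ∫ z, siteZ P (lam * q) (σ * xs i) z ^ θ ∂(gaussianReal 0 1) := by
  have hr : 0 ≤ lam * q := mul_nonneg hlam hq
  set S : Set (Fin N → ℝ) := {x | overlap x xs ∈ A} with hS
  have hSm : MeasurableSet S := measurableSet_overlap_mem hA xs
  have key := integral_interpZ_rpow_le hN (μ := (priorN P N).restrict S) (B := B)
    (ae_restrict_of_ae (ae_priorN_abs_le hB N)) hlam hq hθ hθ1 hσ xs
    ((ae_restrict_iff' hSm).2 (Filter.Eventually.of_forall fun x hx => hAδ _ hx))
  have hend : ∀ g, interpZ ((priorN P N).restrict S) (spikeStat lam q N)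
      (spikeDrift lam q σ xs) (spikePath N (Real.pi / 2)) g =
      overlapZ P lam A xs (observation lam xs fun p => g (Sum.inl p)) :=
    interpZ_end hlam q σ hA xs
  simp only [hend] at key
  rw [integral_comp_measurePreserving (measurePreserving_comp_inl (gaussianReal 0 1))
    (F := fun W => overlapZ P lam A xs (observation lam xs W) ^ θ)
    (Measurable.aestronglyMeasurable (((measurable_overlapZ lam hA).comp
      (measurable_const.prodMk ((measurable_observation lam).comp
        (measurable_const.prodMk measurable_id)))).pow_const θ))] at key
  refine key.trans (mul_le_mul_of_nonneg_left ?_ (Real.exp_pos _).le)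
  have hint : Integrable (fun z : Fin N → ℝ => ∏ i, siteZ P (lam * q) (σ * xs i) (z i) ^ θ)
      (Measure.pi fun _ => gaussianReal 0 1) :=
    Integrable.fintype_prod (f := fun (i : Fin N) (t : ℝ) => siteZ P (lam * q) (σ * xs i) t ^ θ)
      fun i => integrable_siteZ_rpow hB hr _ _
  have mp := measurePreserving_comp_inr (α := Pairs N) (β := Fin N) (gaussianReal 0 1)
  rw [← integral_fintype_prod_eq_prod (fun (i : Fin N) (t : ℝ) =>
    siteZ P (lam * q) (σ * xs i) t ^ θ),
    ← integral_comp_measurePreserving mp hint.aestronglyMeasurable]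
  have hZ0 : ∀ g, 0 ≤ interpZ ((priorN P N).restrict S) (spikeStat lam q N)
      (spikeDrift lam q σ xs) (spikePath N 0) g := fun g => by
    rw [interpZ, interpInt_eq]
    exact integral_nonneg fun x => mul_nonneg zero_le_one (Real.exp_pos _).le
  refine integral_mono_of_nonneg (Filter.Eventually.of_forall fun g => Real.rpow_nonneg (hZ0 g) θ)
    (mp.integrable_comp_of_integrable hint) (Filter.Eventually.of_forall fun g => ?_)
  beta_reduce
  rw [Real.finsetProd_rpow _ _ fun i _ => (siteZ_pos hB hr _ _).le]
  exact Real.rpow_le_rpow (hZ0 g) (interpZ_start_le hB hlam hq σ S xs g) hθ.le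

end Prior

lemma exp_le_one_add_add_sq_mul_exp_abs (u : ℝ) :
    Real.exp u ≤ 1 + u + u ^ 2 * Real.exp |u| := by
  rcases le_total 0 u with hu | hu
  · rw [abs_of_nonneg hu]
    have h1 : Real.exp u - 1 ≤ u * Real.exp u := by
      have h := Real.add_one_le_exp (-u)
      have h2 : Real.exp (-u) * Real.exp u = 1 := by rw [← Real.exp_add]; simp
      nlinarith [Real.exp_pos u]
    nlinarith
  · rw [abs_of_nonpos hu]
    have h1 := Real.add_one_le_exp (-u)
    have h2 : Real.exp u * Real.exp (-u) = 1 := by rw [← Real.exp_add]; simp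
    have h3 := Real.exp_pos u
    have h4 : Real.exp u * (1 - u) ≤ 1 := by nlinarith
    have h5 : Real.exp u ≤ 1 + u + u ^ 2 := by
      refine le_of_mul_le_mul_right ?_ (show 0 < 1 - u by linarith)
      nlinarith [mul_nonneg (neg_nonneg.2 hu) (sq_nonneg u)]
    nlinarith [sq_nonneg u]

section ScalarChannel

variable {P : Measure ℝ} [IsProbabilityMeasure P] {B : ℝ}

lemma integrable_prod_of_le_exp {f : ℝ × ℝ → ℝ} (hf : Measurable f) {A C : ℝ}
    (hb : ∀ᵐ p ∂(P.prod (gaussianReal 0 1)), |f p| ≤ A * Real.exp (C * |p.2|)) :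
    Integrable f (P.prod (gaussianReal 0 1)) :=
  Integrable.mono' (((integrable_exp_mul_abs_gaussianReal C).comp_snd P).const_mul A)
    hf.aestronglyMeasurable hb

lemma ae_prod_abs_fst_le (hB : ∀ᵐ x ∂P, |x| ≤ B) :
    ∀ᵐ p ∂(P.prod (gaussianReal 0 1)), |p.1| ≤ B :=
  Measure.quasiMeasurePreserving_fst.ae hB

/-- An envelope of the logarithm of the scalar partition function. -/
noncomputable def siteEnvelope (r B z : ℝ) : ℝ :=
  Real.sqrt r * B * |z| + r * B * B + r / 2 * B ^ 2

lemma abs_log_siteZ_le_envelope (hB : ∀ᵐ x ∂P, |x| ≤ B) {r : ℝ} (hr : 0 ≤ r) (hB0 : 0 ≤ B)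
    {y : ℝ} (hy : |y| ≤ B) (z : ℝ) : |Real.log (siteZ P r y z)| ≤ siteEnvelope r B z := by
  refine (abs_log_siteZ_le hB hr y z).trans ?_
  have := mul_le_mul_of_nonneg_left hy (mul_nonneg hr hB0)
  simp only [siteEnvelope]
  linarith

lemma siteEnvelope_le_exp (r B z : ℝ) :
    siteEnvelope r B z ≤ Real.exp (r * B * B + r / 2 * B ^ 2) *
      Real.exp ((Real.sqrt r * B) * |z|) := by
  rw [← Real.exp_add]
  have := Real.add_one_le_exp (r * B * B + r / 2 * B ^ 2 + Real.sqrt r * B * |z|)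
  simp only [siteEnvelope]
  linarith

lemma measurable_log_siteZ (r : ℝ) {f g : ℝ × ℝ → ℝ} (hf : Measurable f) (hg : Measurable g) :
    Measurable (fun p => Real.log (siteZ P r (f p) (g p))) :=
  Real.measurable_log.comp ((measurable_siteZ r).comp (hf.prodMk hg))

lemma integrable_log_siteZ (hB : ∀ᵐ x ∂P, |x| ≤ B) {r : ℝ} (hr : 0 ≤ r) (hB0 : 0 ≤ B)
    {σ : ℝ} (hσ : |σ| = 1) :
    Integrable (fun p : ℝ × ℝ => Real.log (siteZ P r (σ * p.1) p.2))
      (P.prod (gaussianReal 0 1)) := by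
  refine integrable_prod_of_le_exp
    (measurable_log_siteZ r (measurable_fst.const_mul σ) measurable_snd)
    (A := Real.exp (r * B * B + r / 2 * B ^ 2)) (C := Real.sqrt r * B) ?_
  filter_upwards [ae_prod_abs_fst_le hB] with p hp
  exact (abs_log_siteZ_le_envelope hB hr hB0 (by rwa [abs_mul, hσ, one_mul]) _).trans
    (siteEnvelope_le_exp r B p.2)

lemma siteZ_rpow_le_envelope (hB : ∀ᵐ x ∂P, |x| ≤ B) {r : ℝ} (hr : 0 ≤ r) (hB0 : 0 ≤ B)
    {y θ : ℝ} (hθ : 0 ≤ θ) (hθ1 : θ ≤ 1) (hy : |y| ≤ B) (z : ℝ) :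
    siteZ P r y z ^ θ ≤ 1 + θ * Real.log (siteZ P r y z) +
      θ ^ 2 * Real.exp (3 * siteEnvelope r B z) := by
  have hpos := siteZ_pos hB hr y z
  set L := Real.log (siteZ P r y z) with hL
  have h1 : |L| ≤ siteEnvelope r B z := abs_log_siteZ_le_envelope hB hr hB0 hy z
  set M := siteEnvelope r B z with hM
  rw [Real.rpow_def_of_pos hpos, mul_comm]
  have h2 := exp_le_one_add_add_sq_mul_exp_abs (θ * L)
  have h3 : L ^ 2 ≤ Real.exp (2 * M) := by
    have h4 : |L| ≤ Real.exp M := h1.trans (by linarith [Real.add_one_le_exp M])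
    calc L ^ 2 = |L| ^ 2 := (sq_abs L).symm
      _ ≤ Real.exp M ^ 2 := pow_le_pow_left₀ (abs_nonneg _) h4 2
      _ = Real.exp (2 * M) := by rw [← Real.exp_nat_mul]; norm_num
  have h5 : Real.exp |θ * L| ≤ Real.exp M := by
    refine Real.exp_le_exp.2 ?_
    rw [abs_mul, abs_of_nonneg hθ]
    exact (mul_le_of_le_one_left (abs_nonneg _) hθ1).trans h1
  have h6 : (θ * L) ^ 2 * Real.exp |θ * L| ≤ θ ^ 2 * Real.exp (3 * M) := by
    calc (θ * L) ^ 2 * Real.exp |θ * L| = θ ^ 2 * (L ^ 2 * Real.exp |θ * L|) := by ring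
      _ ≤ θ ^ 2 * (Real.exp (2 * M) * Real.exp M) := by gcongr
      _ = _ := by rw [← Real.exp_add]; ring_nf
  linarith

lemma integrable_exp_siteEnvelope (r B : ℝ) :
    Integrable (fun z => Real.exp (3 * siteEnvelope r B z)) (gaussianReal 0 1) := by
  refine ((integrable_exp_mul_abs_gaussianReal (3 * (Real.sqrt r * B))).const_mul
    (Real.exp (3 * (r * B * B + r / 2 * B ^ 2)))).congr (Filter.Eventually.of_forall fun z => ?_)
  simp only [siteEnvelope]
  rw [← Real.exp_add]
  ring_nf

/-- The second-order remainder in the expansion of the fractional moments of the scalar channel. -/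
noncomputable def siteRemainder (r B : ℝ) : ℝ :=
  ∫ z, Real.exp (3 * siteEnvelope r B z) ∂(gaussianReal 0 1)

lemma integrable_siteZ_rpow_prod (hB : ∀ᵐ x ∂P, |x| ≤ B) {r : ℝ} (hr : 0 ≤ r) (hB0 : 0 ≤ B)
    {θ σ : ℝ} (hθ : 0 ≤ θ) (hθ1 : θ ≤ 1) (hσ : |σ| = 1) :
    Integrable (fun p : ℝ × ℝ => siteZ P r (σ * p.1) p.2 ^ θ) (P.prod (gaussianReal 0 1)) := by
  refine Integrable.mono' (((integrable_const (1 : ℝ)).add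
    ((integrable_log_siteZ hB hr hB0 hσ).const_mul θ)).add
    (((integrable_exp_siteEnvelope r B).comp_snd P).const_mul (θ ^ 2)))
    (Measurable.aestronglyMeasurable (((measurable_siteZ r).comp
      ((measurable_fst.const_mul σ).prodMk measurable_snd)).pow_const θ)) ?_
  filter_upwards [ae_prod_abs_fst_le hB] with p hp
  rw [Real.norm_eq_abs, abs_of_nonneg (Real.rpow_nonneg (siteZ_pos hB hr _ _).le _)]
  exact siteZ_rpow_le_envelope hB hr hB0 hθ hθ1 (by rwa [abs_mul, hσ, one_mul]) _

lemma integral_siteZ_rpow_le (hB : ∀ᵐ x ∂P, |x| ≤ B) {r : ℝ} (hr : 0 ≤ r) (hB0 : 0 ≤ B)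
    {θ σ : ℝ} (hθ : 0 ≤ θ) (hθ1 : θ ≤ 1) (hσ : |σ| = 1) :
    ∫ p : ℝ × ℝ, siteZ P r (σ * p.1) p.2 ^ θ ∂(P.prod (gaussianReal 0 1)) ≤
      Real.exp (θ * (∫ p : ℝ × ℝ, Real.log (siteZ P r (σ * p.1) p.2) ∂(P.prod (gaussianReal 0 1)) +
        θ * siteRemainder r B)) := by
  have i1 := (integrable_log_siteZ hB hr hB0 hσ).const_mul θ
  have i2 := ((integrable_exp_siteEnvelope r B).comp_snd P).const_mul (θ ^ 2)
  have h1 : ∫ p : ℝ × ℝ, siteZ P r (σ * p.1) p.2 ^ θ ∂(P.prod (gaussianReal 0 1)) ≤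
      ∫ p : ℝ × ℝ, (((fun _ => (1 : ℝ)) + fun p : ℝ × ℝ => θ * Real.log (siteZ P r (σ * p.1) p.2)) +
        fun p : ℝ × ℝ => θ ^ 2 * Real.exp (3 * siteEnvelope r B p.2) : ℝ × ℝ → ℝ) p ∂(P.prod (gaussianReal 0 1)) := by
    refine integral_mono_ae (integrable_siteZ_rpow_prod hB hr hB0 hθ hθ1 hσ)
      (((integrable_const (1 : ℝ)).add i1).add i2) ?_
    filter_upwards [ae_prod_abs_fst_le hB] with p hp
    exact siteZ_rpow_le_envelope hB hr hB0 hθ hθ1 (by rwa [abs_mul, hσ, one_mul]) _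
  rw [integral_add' ((integrable_const (1 : ℝ)).add i1) i2, integral_add' (integrable_const (1 : ℝ)) i1,
    integral_const_mul, integral_const_mul,
    integral_fun_snd (fun z => Real.exp (3 * siteEnvelope r B z))] at h1
  simp only [integral_const, probReal_univ, smul_eq_mul, one_mul] at h1
  refine h1.trans (le_trans (le_of_eq ?_) (Real.add_one_le_exp _))
  simp only [siteRemainder]
  ring

/-! ### The Gibbs inequality for the scalar channel -/

lemma siteZ_eq_shift {r : ℝ} (hr : 0 ≤ r) (y z : ℝ) :
    siteZ P r y z = siteZ P r 0 (z + Real.sqrt r * y) := by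
  simp only [siteZ]
  congr 1
  ext x
  congr 1
  linear_combination (-(x * y)) * Real.mul_self_sqrt hr

lemma lintegral_channel (hB : ∀ᵐ x ∂P, |x| ≤ B) {r : ℝ} (hr : 0 ≤ r) {F : ℝ → ℝ≥0∞}
    (hF : Measurable F) :
    ∫⁻ p : ℝ × ℝ, F (p.2 + Real.sqrt r * p.1) ∂(P.prod (gaussianReal 0 1)) =
      ∫⁻ z, ENNReal.ofReal (siteZ P r 0 z) * F z ∂(gaussianReal 0 1) := by
  rw [lintegral_prod _ (by fun_prop)]
  simp only [lintegral_gaussianReal_add _ hF]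
  rw [lintegral_lintegral_swap (by fun_prop)]
  refine lintegral_congr fun z => ?_
  rw [lintegral_mul_const _ (by fun_prop), siteZ,
    ofReal_integral_eq_lintegral_ofReal (integrable_site hB hr 0 z)
      (Filter.Eventually.of_forall fun _ => (Real.exp_pos _).le)]
  congr 1
  refine lintegral_congr fun x => ?_
  congr 2
  linear_combination (-(x ^ 2 / 2)) * Real.mul_self_sqrt hr

lemma lintegral_siteZ (hB : ∀ᵐ x ∂P, |x| ≤ B) {r : ℝ} (hr : 0 ≤ r) :
    ∫⁻ z, ENNReal.ofReal (siteZ P r 0 z) ∂(gaussianReal 0 1) = 1 := by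
  have := lintegral_channel hB hr (F := fun _ => 1) measurable_const
  simpa using this.symm

lemma psi_eq_integral_log_siteZ (r : ℝ) :
    psi P r = ∫ p : ℝ × ℝ, Real.log (siteZ P r p.1 p.2) ∂(P.prod (gaussianReal 0 1)) := rfl

/-- Relative entropy with respect to the law of the channel output is nonnegative. -/
lemma integral_log_le_psi (hB : ∀ᵐ x ∂P, |x| ≤ B) {r : ℝ} (hr : 0 ≤ r) (hB0 : 0 ≤ B)
    {h : ℝ → ℝ} (hm : Measurable h) (hpos : ∀ y, 0 < h y)
    (hh : ∫⁻ z, ENNReal.ofReal (h z) ∂(gaussianReal 0 1) ≤ 1)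
    (hi : Integrable (fun p : ℝ × ℝ => Real.log (h (p.2 + Real.sqrt r * p.1)))
      (P.prod (gaussianReal 0 1))) :
    ∫ p : ℝ × ℝ, Real.log (h (p.2 + Real.sqrt r * p.1)) ∂(P.prod (gaussianReal 0 1)) ≤
      psi P r := by
  have hΛ : Measurable (siteZ P r 0) :=
    (measurable_siteZ r).comp (measurable_const.prodMk measurable_id)
  set ρ : ℝ × ℝ → ℝ := fun p => h (p.2 + Real.sqrt r * p.1) /
    siteZ P r 0 (p.2 + Real.sqrt r * p.1) with hρ
  have hρm : Measurable ρ := by fun_prop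
  have hρ0 : ∀ p, 0 < ρ p := fun p => div_pos (hpos _) (siteZ_pos hB hr _ _)
  have hl : ∫⁻ p, ENNReal.ofReal (ρ p) ∂(P.prod (gaussianReal 0 1)) ≤ 1 := by
    have := lintegral_channel hB hr (F := fun y => ENNReal.ofReal (h y / siteZ P r 0 y))
      (by fun_prop)
    rw [hρ, this]
    refine le_trans (le_of_eq ?_) hh
    refine lintegral_congr fun z => ?_
    rw [← ENNReal.ofReal_mul (siteZ_pos hB hr _ _).le, mul_div_cancel₀]
    exact (siteZ_pos hB hr _ _).ne'
  have hρi : Integrable ρ (P.prod (gaussianReal 0 1)) := by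
    refine ⟨hρm.aestronglyMeasurable, ?_⟩
    rw [hasFiniteIntegral_iff_ofReal (Filter.Eventually.of_forall fun p => (hρ0 p).le)]
    exact hl.trans_lt ENNReal.one_lt_top
  have hle : ∫ p, ρ p ∂(P.prod (gaussianReal 0 1)) ≤ 1 := by
    rw [integral_eq_lintegral_of_nonneg_ae (Filter.Eventually.of_forall fun p => (hρ0 p).le)
      hρm.aestronglyMeasurable]
    exact ENNReal.toReal_le_of_le_ofReal zero_le_one (by simpa using hl)
  have hlog : Integrable (fun p : ℝ × ℝ => Real.log (siteZ P r p.1 p.2))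
      (P.prod (gaussianReal 0 1)) := by
    simpa using integrable_log_siteZ hB hr hB0 (σ := 1) (by simp)
  rw [psi_eq_integral_log_siteZ, ← sub_nonpos, ← integral_sub hi hlog]
  calc _ ≤ ∫ p, (ρ - fun _ => (1 : ℝ) : ℝ × ℝ → ℝ) p ∂(P.prod (gaussianReal 0 1)) := by
        refine integral_mono (hi.sub hlog) (hρi.sub (integrable_const (1 : ℝ))) fun p => ?_
        simp only [Pi.sub_apply]
        rw [siteZ_eq_shift hr, ← Real.log_div (hpos _).ne' (siteZ_pos hB hr _ _).ne']
        exact Real.log_le_sub_one_of_pos (hρ0 p)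
    _ ≤ 0 := by
        rw [integral_sub' hρi (integrable_const (1 : ℝ))]
        simpa using hle

lemma measurePreserving_neg_gaussianReal :
    MeasurePreserving (fun z : ℝ => -z) (gaussianReal 0 1) (gaussianReal 0 1) :=
  ⟨measurable_neg, by rw [gaussianReal_map_neg, neg_zero]⟩

lemma integral_log_siteZ_neg_le_psi (hB : ∀ᵐ x ∂P, |x| ≤ B) {r : ℝ} (hr : 0 ≤ r) (hB0 : 0 ≤ B) :
    ∫ p : ℝ × ℝ, Real.log (siteZ P r (-1 * p.1) p.2) ∂(P.prod (gaussianReal 0 1)) ≤ psi P r := by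
  have mp : MeasurePreserving (fun p : ℝ × ℝ => (p.1, -p.2)) (P.prod (gaussianReal 0 1))
      (P.prod (gaussianReal 0 1)) :=
    (MeasurePreserving.id P).prod measurePreserving_neg_gaussianReal
  have hint := integrable_log_siteZ hB hr hB0 (σ := -1) (by simp)
  have e : ∀ p : ℝ × ℝ, siteZ P r (-1 * p.1) (-p.2) =
      siteZ P r 0 (-(p.2 + Real.sqrt r * p.1)) := fun p => by
    rw [siteZ_eq_shift hr]
    congr 1
    ring
  have hint' := mp.integrable_comp_of_integrable hint
  simp only [Function.comp_def, e] at hint'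
  have hm : Measurable (fun y => siteZ P r 0 (-y)) :=
    (measurable_siteZ r).comp (measurable_const.prodMk measurable_neg)
  have key := integral_log_le_psi hB hr hB0 hm (fun y => siteZ_pos hB hr 0 (-y)) (by
    have := measurePreserving_neg_gaussianReal.lintegral_comp
      (f := fun y => ENNReal.ofReal (siteZ P r 0 y))
      (((measurable_siteZ r).comp (measurable_const.prodMk measurable_id)).ennreal_ofReal)
    rw [this, lintegral_siteZ hB hr]) hint'
  rw [← integral_comp_measurePreserving mp hint.aestronglyMeasurable]
  simpa only [e] using key

lemma integral_log_siteZ_sign_le_psi (hB : ∀ᵐ x ∂P, |x| ≤ B) {r : ℝ} (hr : 0 ≤ r) (hB0 : 0 ≤ B)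
    {σ : ℝ} (hσ : |σ| = 1) :
    ∫ p : ℝ × ℝ, Real.log (siteZ P r (σ * p.1) p.2) ∂(P.prod (gaussianReal 0 1)) ≤ psi P r := by
  rcases eq_or_eq_neg_of_abs_eq hσ with h | h
  · subst h
    simp only [one_mul]
    exact le_rfl
  · subst h
    exact integral_log_siteZ_neg_le_psi hB hr hB0

lemma mul_sq_mean_le_psi (hB : ∀ᵐ x ∂P, |x| ≤ B) {r : ℝ} (hr : 0 ≤ r) (hB0 : 0 ≤ B) :
    r * (∫ x, x ∂P) ^ 2 / 2 ≤ psi P r := by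
  set m := ∫ x, x ∂P with hm
  set a := Real.sqrt r * m with ha
  have i1 : Integrable (fun p : ℝ × ℝ => p.1) (P.prod (gaussianReal 0 1)) := by
    refine Integrable.comp_fst (f := fun x : ℝ => x) ?_ _
    exact Integrable.mono' (integrable_const B) (by fun_prop) hB
  have i2 : Integrable (fun p : ℝ × ℝ => p.2) (P.prod (gaussianReal 0 1)) :=
    Integrable.comp_snd (f := fun x : ℝ => x)
      ((memLp_id_gaussianReal (μ := 0) (v := 1) 1).integrable le_rfl) _
  have e : ∀ p : ℝ × ℝ, Real.log (Real.exp (a * (p.2 + Real.sqrt r * p.1) - a ^ 2 / 2)) =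
      (((fun p : ℝ × ℝ => a * p.2) + fun p : ℝ × ℝ => a * Real.sqrt r * p.1) - fun _ => a ^ 2 / 2 :
        ℝ × ℝ → ℝ) p := by
    intro p
    rw [Real.log_exp]
    simp only [Pi.add_apply, Pi.sub_apply]
    ring
  have i3 := (i2.const_mul a).add (i1.const_mul (a * Real.sqrt r))
  have i4 := i3.sub (integrable_const (a ^ 2 / 2))
  have key := integral_log_le_psi hB hr hB0 (h := fun y => Real.exp (a * y - a ^ 2 / 2))
    (by fun_prop) (fun _ => Real.exp_pos _) (by
      have := lintegral_gaussianReal_add a (F := fun _ => 1) measurable_const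
      simpa using this.symm.le) (by
      simp only [e]
      exact i4)
  simp only [e] at key
  rw [integral_sub' i3 (integrable_const _), integral_add' (i2.const_mul a) (i1.const_mul _),
    integral_const_mul, integral_const_mul, integral_fun_snd (fun x : ℝ => x),
    integral_fun_fst (fun x : ℝ => x), integral_id_gaussianReal, ← hm] at key
  simp only [smul_zero, mul_zero, integral_const, probReal_univ, one_smul, zero_add] at key
  refine le_trans (le_of_eq ?_) key
  rw [ha]
  linear_combination (-(m ^ 2 / 2)) * Real.mul_self_sqrt hr

end ScalarChannel

/-- The partition function of the posterior. -/
noncomputable def fullZ {N : ℕ} (P : Measure ℝ) (lam : ℝ) (Y : Pairs N → ℝ) : ℝ :=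
  ∫ x, Real.exp (negHamiltonian lam Y x) ∂(priorN P N)

section Partition

variable {P : Measure ℝ} [IsProbabilityMeasure P] {B : ℝ} {N : ℕ}

lemma measurable_fullZ (lam : ℝ) : Measurable (fun Y : Pairs N → ℝ => fullZ P lam Y) := by
  unfold fullZ
  exact (StronglyMeasurable.integral_prod_right (f := fun (Y : Pairs N → ℝ) (x : Fin N → ℝ) =>
    Real.exp (negHamiltonian lam Y x))
    (Real.measurable_exp.comp (measurable_negHamiltonian lam)).stronglyMeasurable).measurable

lemma abs_negHamiltonian_le {lam : ℝ} (hlam : 0 ≤ lam) (Y : Pairs N → ℝ) {x : Fin N → ℝ}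
    (hx : ∀ i, |x i| ≤ B) :
    |negHamiltonian lam Y x| ≤
      ∑ p, (Real.sqrt (lam / N) * |Y p| * B * B + lam / (2 * N) * B ^ 2 * B ^ 2) := by
  refine (Finset.abs_sum_le_sum_abs _ _).trans (Finset.sum_le_sum fun p _ => ?_)
  have h1 := hx p.1.1
  have h2 := hx p.1.2
  have hB0 : 0 ≤ B := (abs_nonneg _).trans h1
  refine (abs_sub _ _).trans (add_le_add ?_ ?_)
  · rw [abs_mul, abs_mul, abs_mul, abs_of_nonneg (Real.sqrt_nonneg _)]
    exact mul_le_mul (mul_le_mul_of_nonneg_left h1 (by positivity)) h2 (abs_nonneg _)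
      (by positivity)
  · rw [abs_mul, abs_mul, abs_pow, abs_pow, abs_of_nonneg (by positivity : 0 ≤ lam / (2 * N))]
    gcongr

lemma integrable_exp_negHamiltonian (hB : ∀ᵐ x ∂P, |x| ≤ B) {lam : ℝ} (hlam : 0 ≤ lam)
    (Y : Pairs N → ℝ) :
    Integrable (fun x => Real.exp (negHamiltonian lam Y x)) (priorN P N) := by
  refine Integrable.mono' (integrable_const (Real.exp (∑ p, (Real.sqrt (lam / N) * |Y p| * B * B +
    lam / (2 * N) * B ^ 2 * B ^ 2)))) (Real.measurable_exp.comp ((measurable_negHamiltonian lam).comp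
      (measurable_const.prodMk measurable_id))).aestronglyMeasurable ?_
  filter_upwards [ae_priorN_abs_le hB N] with x hx
  rw [Real.norm_eq_abs, Real.abs_exp]
  exact Real.exp_le_exp.2 ((le_abs_self _).trans (abs_negHamiltonian_le hlam Y hx))

lemma fullZ_pos (hB : ∀ᵐ x ∂P, |x| ≤ B) {lam : ℝ} (hlam : 0 ≤ lam) (Y : Pairs N → ℝ) :
    0 < fullZ P lam Y :=
  integral_exp_pos (integrable_exp_negHamiltonian hB hlam Y)

lemma integrable_indicator_mul_exp_negHamiltonian (hB : ∀ᵐ x ∂P, |x| ≤ B) {lam : ℝ}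
    (hlam : 0 ≤ lam) {S : Set (Fin N → ℝ)} (hS : MeasurableSet S) (Y : Pairs N → ℝ) :
    Integrable (fun x => S.indicator (fun _ => (1 : ℝ)) x * Real.exp (negHamiltonian lam Y x))
      (priorN P N) := by
  refine ((integrable_exp_negHamiltonian hB hlam Y).indicator hS).congr
    (Filter.Eventually.of_forall fun x => ?_)
  by_cases h : x ∈ S <;> simp [h]

lemma overlapZ_le_fullZ (hB : ∀ᵐ x ∂P, |x| ≤ B) {lam : ℝ} (hlam : 0 ≤ lam) (A : Set ℝ)
    (xs : Fin N → ℝ) (Y : Pairs N → ℝ) : overlapZ P lam A xs Y ≤ fullZ P lam Y := by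
  refine integral_mono_of_nonneg (Filter.Eventually.of_forall fun x =>
    mul_nonneg (Set.indicator_nonneg (fun _ _ => zero_le_one) _) (Real.exp_pos _).le)
    (integrable_exp_negHamiltonian hB hlam Y) (Filter.Eventually.of_forall fun x => ?_)
  exact mul_le_of_le_one_left (Real.exp_pos _).le
    (Set.indicator_le' (fun _ _ => le_rfl) (fun _ _ => zero_le_one) x)

lemma observation_eq_add (lam : ℝ) (xs : Fin N → ℝ) (W : Pairs N → ℝ) :
    observation lam xs W = W + fun p : Pairs N => Real.sqrt (lam / N) * xs p.1.1 * xs p.1.2 := by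
  ext p
  simp only [observation, Pi.add_apply]
  ring

lemma negHamiltonian_eq {lam : ℝ} (hlam : 0 ≤ lam) (xs : Fin N → ℝ) (W : Pairs N → ℝ) :
    negHamiltonian lam W xs = ∑ p : Pairs N, ((Real.sqrt (lam / N) * xs p.1.1 * xs p.1.2) * W p -
      (Real.sqrt (lam / N) * xs p.1.1 * xs p.1.2) ^ 2 / 2) := by
  refine Finset.sum_congr rfl fun p _ => ?_
  have s1 : Real.sqrt (lam / N) ^ 2 = lam / N := Real.sq_sqrt (by positivity)
  have s2 : lam / (2 * N) = lam / N / 2 := by rw [div_div, mul_comm]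
  rw [s2]
  linear_combination (xs p.1.1 ^ 2 * xs p.1.2 ^ 2 / 2) * s1

lemma lintegral_observation {lam : ℝ} (hlam : 0 ≤ lam) {F : (Pairs N → ℝ) → ℝ≥0∞}
    (hF : Measurable F) (xs : Fin N → ℝ) :
    ∫⁻ W, F (observation lam xs W) ∂(noiseLaw N) =
      ∫⁻ W, ENNReal.ofReal (Real.exp (negHamiltonian lam W xs)) * F W ∂(noiseLaw N) := by
  simp only [observation_eq_add, negHamiltonian_eq hlam]
  exact lintegral_stdGaussian_add
    (fun p : Pairs N => Real.sqrt (lam / N) * xs p.1.1 * xs p.1.2) hF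

lemma ofReal_fullZ (hB : ∀ᵐ x ∂P, |x| ≤ B) {lam : ℝ} (hlam : 0 ≤ lam) (Y : Pairs N → ℝ) :
    ENNReal.ofReal (fullZ P lam Y) =
      ∫⁻ x, ENNReal.ofReal (Real.exp (negHamiltonian lam Y x)) ∂(priorN P N) :=
  ofReal_integral_eq_lintegral_ofReal (integrable_exp_negHamiltonian hB hlam Y)
    (Filter.Eventually.of_forall fun _ => (Real.exp_pos _).le)

lemma measurable_ofReal_exp_negHamiltonian (lam : ℝ) (Y : Pairs N → ℝ) :
    Measurable (fun x : Fin N → ℝ => ENNReal.ofReal (Real.exp (negHamiltonian lam Y x))) := by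
  unfold negHamiltonian
  fun_prop

lemma lintegral_planted (hB : ∀ᵐ x ∂P, |x| ≤ B) {lam : ℝ} (hlam : 0 ≤ lam)
    {F : (Pairs N → ℝ) → ℝ≥0∞} (hF : Measurable F) :
    ∫⁻ ω, F (observation lam ω.1 ω.2) ∂((priorN P N).prod (noiseLaw N)) =
      ∫⁻ Y, ENNReal.ofReal (fullZ P lam Y) * F Y ∂(noiseLaw N) := by
  have hFo : Measurable (fun ω : (Fin N → ℝ) × (Pairs N → ℝ) => F (observation lam ω.1 ω.2)) :=
    hF.comp (measurable_observation lam)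
  have hm : Measurable (fun q : (Fin N → ℝ) × (Pairs N → ℝ) =>
      ENNReal.ofReal (Real.exp (negHamiltonian lam q.2 q.1))) :=
    (Real.measurable_exp.comp ((measurable_negHamiltonian lam).comp
      (measurable_snd.prodMk measurable_fst))).ennreal_ofReal
  have hmF : Measurable (fun q : (Fin N → ℝ) × (Pairs N → ℝ) =>
      ENNReal.ofReal (Real.exp (negHamiltonian lam q.2 q.1)) * F q.2) :=
    hm.mul (hF.comp measurable_snd)
  calc _ = ∫⁻ xs, ∫⁻ W, F (observation lam xs W) ∂(noiseLaw N) ∂(priorN P N) :=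
        lintegral_prod _ hFo.aemeasurable
    _ = ∫⁻ xs, ∫⁻ W, ENNReal.ofReal (Real.exp (negHamiltonian lam W xs)) * F W
          ∂(noiseLaw N) ∂(priorN P N) :=
        lintegral_congr fun xs => lintegral_observation hlam hF xs
    _ = ∫⁻ W, ∫⁻ xs, ENNReal.ofReal (Real.exp (negHamiltonian lam W xs)) * F W
          ∂(priorN P N) ∂(noiseLaw N) := lintegral_lintegral_swap hmF.aemeasurable
    _ = _ := lintegral_congr fun W => by
        rw [lintegral_mul_const _ (measurable_ofReal_exp_negHamiltonian lam W), ofReal_fullZ hB hlam]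

/-- Negative fractional moments of the partition function are at most one in the planted model. -/
lemma lintegral_fullZ_rpow_neg_le_one (hB : ∀ᵐ x ∂P, |x| ≤ B) {lam : ℝ} (hlam : 0 ≤ lam)
    {θ : ℝ} (hθ : 0 ≤ θ) (hθ1 : θ ≤ 1) :
    ∫⁻ ω, ENNReal.ofReal (fullZ P lam (observation lam ω.1 ω.2) ^ (-θ))
      ∂((priorN P N).prod (noiseLaw N)) ≤ 1 := by
  have hm := measurable_fullZ (P := P) (N := N) lam
  rw [lintegral_planted hB hlam (F := fun Y => ENNReal.ofReal (fullZ P lam Y ^ (-θ)))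
    (hm.pow_const _).ennreal_ofReal]
  have hone : ∫⁻ Y, ENNReal.ofReal (fullZ P lam Y) ∂(noiseLaw N) = 1 := by
    have := lintegral_planted (P := P) (N := N) hB hlam (F := fun _ => 1) measurable_const
    simpa using this.symm
  calc _ ≤ ∫⁻ Y, (ENNReal.ofReal θ + ENNReal.ofReal (1 - θ) * ENNReal.ofReal (fullZ P lam Y))
        ∂(noiseLaw N) := by
        refine lintegral_mono fun Y => ?_
        have hZ := fullZ_pos (N := N) hB hlam Y
        have h1 : (0 : ℝ) ≤ 1 - θ := by linarith
        rw [← ENNReal.ofReal_mul hZ.le, ← ENNReal.ofReal_mul h1,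
          ← ENNReal.ofReal_add hθ (mul_nonneg h1 hZ.le)]
        refine ENNReal.ofReal_le_ofReal ?_
        have h2 := Real.geom_mean_le_arith_mean2_weighted hθ h1 zero_le_one hZ.le (by ring)
        rw [Real.one_rpow, one_mul, mul_one] at h2
        refine le_trans (le_of_eq ?_) h2
        rw [sub_eq_add_neg, Real.rpow_add hZ, Real.rpow_one]
    _ = 1 := by
        rw [lintegral_add_left measurable_const, lintegral_const_mul _ hm.ennreal_ofReal, hone,
          lintegral_const, measure_univ, mul_one, mul_one,
          ← ENNReal.ofReal_add hθ (by linarith)]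
        simp

lemma integrable_overlapZ_rpow (hB : ∀ᵐ x ∂P, |x| ≤ B) {lam : ℝ} (hlam : 0 ≤ lam) {θ : ℝ}
    (hθ : 0 < θ) {A : Set ℝ} (hA : MeasurableSet A) (xs : Fin N → ℝ) :
    Integrable (fun W => overlapZ P lam A xs (observation lam xs W) ^ θ) (noiseLaw N) := by
  have hm : Measurable (fun W => overlapZ P lam A xs (observation lam xs W) ^ θ) :=
    ((measurable_overlapZ lam hA).comp (measurable_const.prodMk ((measurable_observation lam).comp
      (measurable_const.prodMk measurable_id)))).pow_const θ
  have mp := measurePreserving_comp_inl (α := Pairs N) (β := Fin N) (gaussianReal 0 1)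
  refine (mp.integrable_comp hm.aestronglyMeasurable).1 ?_
  have e : (fun W => overlapZ P lam A xs (observation lam xs W) ^ θ) ∘
      (fun (g : Pairs N ⊕ Fin N → ℝ) (i : Pairs N) => g (Sum.inl i)) = fun g =>
      interpZ ((priorN P N).restrict {x | overlap x xs ∈ A}) (spikeStat lam 0 N)
        (spikeDrift lam 0 1 xs) (spikePath N (Real.pi / 2)) g ^ θ := by
    ext g
    rw [interpZ_end hlam 0 1 hA xs]
    rfl
  rw [e]
  by_cases hμ : (priorN P N).restrict {x | overlap x xs ∈ A} = 0
  · rw [hμ]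
    simp [interpZ, interpInt, expInt, Real.zero_rpow hθ.ne']
  have hb : ∀ᵐ x ∂((priorN P N).restrict {x | overlap x xs ∈ A}), ∀ k,
      |spikeStat lam 0 N k x| ≤ Real.sqrt (lam / N) * |B| * |B| + Real.sqrt (lam * 0) * |B| :=
    ae_restrict_of_ae ((ae_priorN_abs_le hB N).mono fun x hx k => abs_spikeStat_le hx k)
  exact (expGrowth_interpZ_rpow (measurable_spikeStat lam 0 N) hb hμ (by positivity) hθ.le
    (abs_spikePath_le N _)).integrable
    (continuous_interpZ_rpow (measurable_spikeStat lam 0 N) hb hμ _ θ).aestronglyMeasurable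

/-- The planted fractional moment of the partition function at a fixed overlap. -/
lemma lintegral_overlapZ_rpow_le (hN : 1 ≤ N) (hB : ∀ᵐ x ∂P, |x| ≤ B) (hB0 : 0 ≤ B)
    {lam q δ θ σ : ℝ} (hlam : 0 ≤ lam) (hq : 0 ≤ q) (hθ : 0 < θ) (hθ1 : θ ≤ 1) (hσ : |σ| = 1)
    {A : Set ℝ} (hA : MeasurableSet A) (hAδ : ∀ t ∈ A, |t - σ * q| ≤ δ) :
    ∫⁻ ω, ENNReal.ofReal (overlapZ P lam A ω.1 (observation lam ω.1 ω.2) ^ θ)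
      ∂((priorN P N).prod (noiseLaw N)) ≤
      ENNReal.ofReal (Real.exp (θ * N * interpRate lam q δ B θ N / 2) *
        Real.exp (N * (θ * (psi P (lam * q) + θ * siteRemainder (lam * q) B)))) := by
  have hr : 0 ≤ lam * q := mul_nonneg hlam hq
  have hσ2 : σ ^ 2 = 1 := by rw [← sq_abs, hσ, one_pow]
  have hm : Measurable (fun ω : (Fin N → ℝ) × (Pairs N → ℝ) =>
      ENNReal.ofReal (overlapZ P lam A ω.1 (observation lam ω.1 ω.2) ^ θ)) :=
    (((measurable_overlapZ lam hA).comp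
      (measurable_fst.prodMk (measurable_observation lam))).pow_const θ).ennreal_ofReal
  rw [lintegral_prod _ hm.aemeasurable]
  set φ : ℝ → ℝ := fun y => ∫ z, siteZ P (lam * q) (σ * y) z ^ θ ∂(gaussianReal 0 1) with hφ
  have hφ0 : ∀ y, 0 ≤ φ y := fun y =>
    integral_nonneg fun z => Real.rpow_nonneg (siteZ_pos hB hr _ _).le _
  have hpi := integrable_siteZ_rpow_prod hB hr hB0 hθ.le hθ1 hσ
  have hφi : Integrable φ P := hpi.integral_prod_left
  set K := Real.exp (θ * N * interpRate lam q δ B θ N / 2) with hK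
  calc _ ≤ ∫⁻ xs, ENNReal.ofReal (K * ∏ i, φ (xs i)) ∂(priorN P N) := by
        refine lintegral_mono fun xs => ?_
        rw [← ofReal_integral_eq_lintegral_ofReal (integrable_overlapZ_rpow hB hlam hθ hA xs)
          (Filter.Eventually.of_forall fun W => Real.rpow_nonneg (overlapZ_nonneg _ _ _ _) _)]
        exact ENNReal.ofReal_le_ofReal
          (integral_overlapZ_rpow_le hN hB hlam hq hθ hθ1 hσ2 hA hAδ xs)
    _ = ENNReal.ofReal (K * (∫ y, φ y ∂P) ^ N) := by
        rw [← ofReal_integral_eq_lintegral_ofReal, integral_const_mul]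
        · have := integral_fintype_prod_eq_pow (ι := Fin N) (μ := P) φ
          rw [Fintype.card_fin] at this
          rw [← this]
          rfl
        · exact (Integrable.fintype_prod (f := fun (_ : Fin N) => φ) fun _ => hφi).const_mul K
        · exact Filter.Eventually.of_forall fun xs =>
            mul_nonneg (Real.exp_pos _).le (Finset.prod_nonneg fun i _ => hφ0 _)
    _ ≤ _ := by
        refine ENNReal.ofReal_le_ofReal (mul_le_mul_of_nonneg_left ?_ (Real.exp_pos _).le)
        rw [Real.exp_nat_mul]
        refine pow_le_pow_left₀ (integral_nonneg hφ0) ?_ N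
        rw [hφ, ← integral_prod _ hpi]
        refine (integral_siteZ_rpow_le hB hr hB0 hθ.le hθ1 hσ).trans (Real.exp_le_exp.2 ?_)
        have := integral_log_siteZ_sign_le_psi hB hr hB0 hσ
        gcongr

/-- The planted posterior probability that the overlap is in `A`. -/
noncomputable def overlapProb (P : Measure ℝ) (lam : ℝ) (N : ℕ) (A : Set ℝ) : ℝ≥0∞ :=
  ∫⁻ ω, ENNReal.ofReal (overlapZ P lam A ω.1 (observation lam ω.1 ω.2) /
    fullZ P lam (observation lam ω.1 ω.2)) ∂((priorN P N).prod (noiseLaw N))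

lemma ratio_le_fractional {a z κ θ : ℝ} (ha : 0 ≤ a) (hz : 0 < z) (haz : a ≤ z) (hκ : 0 < κ)
    (hθ1 : θ ≤ 1) :
    a / z ≤ κ / 2 * a ^ θ + κ⁻¹ / 2 * z ^ (-θ) := by
  have hρ0 : 0 ≤ a / z := div_nonneg ha hz.le
  have hρ1 : a / z ≤ 1 := (div_le_one hz).2 haz
  have h1 : (a / z) ^ 2 ≤ a ^ θ * z ^ (-θ) := by
    have h2 : (a / z) ^ θ = a ^ θ * z ^ (-θ) := by
      rw [Real.div_rpow ha hz.le, Real.rpow_neg hz.le, div_eq_mul_inv]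
    rw [← h2]
    calc (a / z) ^ 2 ≤ a / z := by nlinarith
      _ = (a / z) ^ (1 : ℝ) := (Real.rpow_one _).symm
      _ ≤ (a / z) ^ θ := Real.rpow_le_rpow_of_exponent_ge_of_imp hρ0 hρ1 hθ1 (by
          intro _ h; norm_num at h)
  have hA : 0 ≤ a ^ θ := Real.rpow_nonneg ha θ
  have hZ : 0 ≤ z ^ (-θ) := Real.rpow_nonneg hz.le _
  refine abs_le_of_sq_le_sq' ?_ (by positivity) |>.2
  have h3 : κ * κ⁻¹ = 1 := mul_inv_cancel₀ hκ.ne'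
  have h4 := sq_nonneg (κ / 2 * a ^ θ - κ⁻¹ / 2 * z ^ (-θ))
  have h5 : (κ / 2 * a ^ θ + κ⁻¹ / 2 * z ^ (-θ)) ^ 2 =
      (κ / 2 * a ^ θ - κ⁻¹ / 2 * z ^ (-θ)) ^ 2 + (κ * κ⁻¹) * (a ^ θ * z ^ (-θ)) := by ring
  rw [h5, h3]
  linarith

end Partition

/-- Exponential decay of the probability that the overlap is near a point where the potential is
negative. -/
theorem exists_overlapProb_ball_le {P : Measure ℝ} [IsProbabilityMeasure P] {B : ℝ}
    (hB : ∀ᵐ x ∂P, |x| ≤ B) (hB0 : 0 ≤ B) {lam q σ : ℝ} (hlam : 0 ≤ lam) (hq : 0 ≤ q)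
    (hσ : |σ| = 1) (hψ : psi P (lam * q) < lam * q ^ 2 / 4) :
    ∃ δ C c : ℝ, 0 < δ ∧ 0 ≤ C ∧ 0 < c ∧ ∀ N : ℕ, 1 ≤ N →
      overlapProb P lam N (Metric.ball (σ * q) δ) ≤ ENNReal.ofReal (C * Real.exp (-c * N)) := by
  set κ := (lam * q ^ 2 / 4 - psi P (lam * q)) / 4 with hκ
  have hκ0 : 0 < κ := by linarith
  set Rm := siteRemainder (lam * q) B with hRm
  have hRm0 : 0 ≤ Rm := integral_nonneg fun _ => (Real.exp_pos _).le
  set θ := min 1 (κ / (Rm + 1)) with hθ_def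
  have hθ : 0 < θ := lt_min one_pos (by positivity)
  have hθ1 : θ ≤ 1 := min_le_left _ _
  have hθR : θ * Rm ≤ κ := by
    have h1 : θ * (Rm + 1) ≤ κ := (le_div_iff₀ (by positivity)).1 (min_le_right _ _)
    linarith
  set δ := Real.sqrt (κ / (lam + 1)) with hδ_def
  have hδ : 0 < δ := Real.sqrt_pos.2 (by positivity)
  have hδ2 : lam * δ ^ 2 ≤ κ := by
    rw [hδ_def, Real.sq_sqrt (by positivity), mul_div_assoc', div_le_iff₀ (by positivity)]
    nlinarith
  refine ⟨δ, Real.exp (θ * lam * B ^ 4 / 4) / 2 + 1 / 2, θ * κ, hδ, by positivity, by positivity,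
    fun N hN => ?_⟩
  have hN0 : (0 : ℝ) < N := by exact_mod_cast hN
  set A := Metric.ball (σ * q) δ with hA_def
  have hA : MeasurableSet A := Metric.isOpen_ball.measurableSet
  have h1 := lintegral_overlapZ_rpow_le hN hB hB0 hlam hq hθ hθ1 hσ hA
    (δ := δ) (fun t ht => (Real.dist_eq t _ ▸ Metric.mem_ball.1 ht).le)
  have h2 := lintegral_fullZ_rpow_neg_le_one (N := N) hB hlam hθ.le hθ1
  have h3 : Real.exp (θ * N * interpRate lam q δ B θ N / 2) *
        Real.exp (N * (θ * (psi P (lam * q) + θ * Rm))) ≤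
      Real.exp (θ * lam * B ^ 4 / 4) * Real.exp (-(2 * (θ * κ) * N)) := by
    rw [← Real.exp_add, ← Real.exp_add]
    refine Real.exp_le_exp.2 ?_
    have e1 : θ * N * interpRate lam q δ B θ N / 2 = θ * N * (lam * δ ^ 2 / 2) -
        θ * N * ((1 + θ) * lam * q ^ 2 / 4) + θ * lam * B ^ 4 / 4 := by
      rw [interpRate]
      field_simp
      ring
    have e2 : psi P (lam * q) = lam * q ^ 2 / 4 - 4 * κ := by rw [hκ]; ring
    rw [e1, e2]
    have t1 : 0 ≤ θ * N := by positivity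
    have t2 := mul_le_mul_of_nonneg_left hδ2 t1
    have t3 := mul_le_mul_of_nonneg_left hθR t1
    have t4 : 0 ≤ θ * N * (θ * (lam * q ^ 2)) := by positivity
    have t5 : 0 ≤ θ * N * κ := by positivity
    nlinarith
  set k := Real.exp (θ * κ * N) with hk
  have hk0 : 0 < k := Real.exp_pos _
  have hmA : Measurable (fun ω : (Fin N → ℝ) × (Pairs N → ℝ) =>
      ENNReal.ofReal (overlapZ P lam A ω.1 (observation lam ω.1 ω.2) ^ θ)) :=
    (((measurable_overlapZ lam hA).comp
      (measurable_fst.prodMk (measurable_observation lam))).pow_const θ).ennreal_ofReal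
  have hmZ : Measurable (fun ω : (Fin N → ℝ) × (Pairs N → ℝ) =>
      ENNReal.ofReal (fullZ P lam (observation lam ω.1 ω.2) ^ (-θ))) :=
    (((measurable_fullZ lam).comp (measurable_observation lam)).pow_const _).ennreal_ofReal
  calc overlapProb P lam N A
      ≤ ∫⁻ ω, (ENNReal.ofReal (k / 2) *
          ENNReal.ofReal (overlapZ P lam A ω.1 (observation lam ω.1 ω.2) ^ θ) +
          ENNReal.ofReal (k⁻¹ / 2) * ENNReal.ofReal (fullZ P lam (observation lam ω.1 ω.2) ^ (-θ)))
          ∂((priorN P N).prod (noiseLaw N)) := by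
        refine lintegral_mono fun ω => ?_
        have hZ := fullZ_pos hB hlam (observation lam ω.1 ω.2)
        have hZA := overlapZ_nonneg (P := P) lam A ω.1 (observation lam ω.1 ω.2)
        rw [← ENNReal.ofReal_mul (by positivity), ← ENNReal.ofReal_mul (by positivity),
          ← ENNReal.ofReal_add (mul_nonneg (by positivity) (Real.rpow_nonneg hZA _))
            (mul_nonneg (by positivity) (Real.rpow_nonneg hZ.le _))]
        exact ENNReal.ofReal_le_ofReal (ratio_le_fractional hZA hZ
          (overlapZ_le_fullZ hB hlam A _ _) hk0 hθ1)
    _ ≤ ENNReal.ofReal (k / 2) * ENNReal.ofReal (Real.exp (θ * lam * B ^ 4 / 4) *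
          Real.exp (-(2 * (θ * κ) * N))) + ENNReal.ofReal (k⁻¹ / 2) * 1 := by
        rw [lintegral_add_left (hmA.const_mul _), lintegral_const_mul _ hmA,
          lintegral_const_mul _ hmZ]
        exact add_le_add (mul_le_mul_right (h1.trans (ENNReal.ofReal_le_ofReal h3)) _)
          (mul_le_mul_right h2 _)
    _ = _ := by
        rw [mul_one, ← ENNReal.ofReal_mul (by positivity),
          ← ENNReal.ofReal_add (by positivity) (by positivity)]
        congr 1
        have e1 : k * Real.exp (-(2 * (θ * κ) * N)) = Real.exp (-(θ * κ) * N) := by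
          rw [hk, ← Real.exp_add]
          ring_nf
        have e2 : k⁻¹ = Real.exp (-(θ * κ) * N) := by
          rw [hk, ← Real.exp_neg]
          ring_nf
        rw [e2, ← e1]
        ring

section Threshold

variable {P : Measure ℝ} [IsProbabilityMeasure P]

lemma psi_zero : psi P 0 = 0 := by
  simp [psi]

/-- Below the threshold, `ψ` is dominated by a parabola with a strictly larger signal strength. -/
lemma exists_psi_lt_of_lt_reconstructionThreshold {lam : ℝ}
    (h : ENNReal.ofReal lam < reconstructionThreshold P) :
    ∃ lam' : ℝ, lam < lam' ∧ ∀ r : ℝ, 0 < r → psi P r < r ^ 2 / (4 * lam') := by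
  obtain ⟨t, ⟨lam', hpos, hmax, rfl⟩, ht⟩ := lt_sSup_iff.1 h
  refine ⟨lam', (ENNReal.ofReal_lt_ofReal_iff hpos).1 ht, fun r hr => ?_⟩
  have := hmax.2 (r / lam') (div_pos hr hpos).le (div_pos hr hpos).ne'
  simp only [rsPotential, mul_zero, psi_zero] at this
  have e1 : lam' * (r / lam') = r := by field_simp
  have e2 : lam' * (r / lam') ^ 2 / 4 = r ^ 2 / (4 * lam') := by field_simp
  rw [e1, e2] at this
  linarith

lemma integral_eq_zero_of_psi_lt {B : ℝ} (hB : ∀ᵐ x ∂P, |x| ≤ B) (hB0 : 0 ≤ B) {lam' : ℝ}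
    (hlam' : 0 < lam') (h : ∀ r : ℝ, 0 < r → psi P r < r ^ 2 / (4 * lam')) :
    ∫ x, x ∂P = 0 := by
  by_contra hm
  set m := ∫ x, x ∂P with hm_def
  have hm2 : 0 < m ^ 2 := by positivity
  have h1 := h (lam' * m ^ 2) (by positivity)
  have h2 := mul_sq_mean_le_psi hB (r := lam' * m ^ 2) (by positivity) hB0
  have h3 : (lam' * m ^ 2) ^ 2 / (4 * lam') = lam' * m ^ 2 * m ^ 2 / 4 := by field_simp
  rw [h3] at h1
  rw [← hm_def] at h2
  have : 0 < lam' * m ^ 2 * m ^ 2 := by positivity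
  linarith

end Threshold

section Assembly

variable {P : Measure ℝ} [IsProbabilityMeasure P] {B : ℝ} {N : ℕ}

lemma abs_overlap_le (hB0 : 0 ≤ B) {x xs : Fin N → ℝ} (hx : ∀ i, |x i| ≤ B)
    (hxs : ∀ i, |xs i| ≤ B) : |overlap x xs| ≤ B * B := by
  rcases Nat.eq_zero_or_pos N with h | h
  · subst h
    simp only [overlap, Finset.univ_eq_empty, Finset.sum_empty, mul_zero, abs_zero]
    positivity
  have hN0 : (0 : ℝ) < N := by exact_mod_cast h
  have h1 : |∑ i, x i * xs i| ≤ N * (B * B) := by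
    refine (Finset.abs_sum_le_sum_abs _ _).trans ?_
    have : ∀ i ∈ Finset.univ, |x i * xs i| ≤ B * B := fun i _ => by
      rw [abs_mul]
      exact mul_le_mul (hx i) (hxs i) (abs_nonneg _) hB0
    simpa using Finset.sum_le_sum this
  rw [overlap, abs_mul, abs_of_pos (by positivity : 0 < 1 / (N : ℝ)), one_div,
    inv_mul_le_iff₀ hN0]
  exact h1

lemma overlapZ_union_le (hB : ∀ᵐ x ∂P, |x| ≤ B) {lam : ℝ} (hlam : 0 ≤ lam) {A A' : Set ℝ}
    (hA : MeasurableSet A) (hA' : MeasurableSet A') (xs : Fin N → ℝ) (Y : Pairs N → ℝ) :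
    overlapZ P lam (A ∪ A') xs Y ≤ overlapZ P lam A xs Y + overlapZ P lam A' xs Y := by
  have i := fun {A : Set ℝ} (hA : MeasurableSet A) =>
    integrable_indicator_mul_exp_negHamiltonian hB hlam (measurableSet_overlap_mem hA xs) Y
  simp only [overlapZ]
  rw [← integral_add (i hA) (i hA')]
  refine integral_mono (i (hA.union hA')) ((i hA).add (i hA')) fun x => ?_
  beta_reduce
  rw [← add_mul]
  refine mul_le_mul_of_nonneg_right ?_ (Real.exp_pos _).le
  by_cases h1 : overlap x xs ∈ A <;> by_cases h2 : overlap x xs ∈ A' <;>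
    simp [Set.indicator, h1, h2]

lemma overlapProb_union_le (hB : ∀ᵐ x ∂P, |x| ≤ B) {lam : ℝ} (hlam : 0 ≤ lam) {A A' : Set ℝ}
    (hA : MeasurableSet A) (hA' : MeasurableSet A') (N : ℕ) :
    overlapProb P lam N (A ∪ A') ≤ overlapProb P lam N A + overlapProb P lam N A' := by
  have hm : Measurable (fun ω : (Fin N → ℝ) × (Pairs N → ℝ) =>
      ENNReal.ofReal (overlapZ P lam A ω.1 (observation lam ω.1 ω.2) /
        fullZ P lam (observation lam ω.1 ω.2))) :=
    (((measurable_overlapZ lam hA).comp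
      (measurable_fst.prodMk (measurable_observation lam))).div
      ((measurable_fullZ lam).comp (measurable_observation lam))).ennreal_ofReal
  unfold overlapProb
  rw [← lintegral_add_left hm]
  refine lintegral_mono fun ω => ?_
  have hZ := fullZ_pos hB hlam (observation lam ω.1 ω.2)
  rw [← ENNReal.ofReal_add (div_nonneg (overlapZ_nonneg _ _ _ _) hZ.le)
    (div_nonneg (overlapZ_nonneg _ _ _ _) hZ.le), ← add_div]
  exact ENNReal.ofReal_le_ofReal
    (div_le_div_of_nonneg_right (overlapZ_union_le hB hlam hA hA' _ _) hZ.le)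

/-- The indicator that the overlap is at least `ε` in absolute value. -/
noncomputable def largeOverlap {N : ℕ} (ε : ℝ) (x xs : Fin N → ℝ) : ℝ :=
  Set.indicator {y : Fin N → ℝ | ε ≤ |overlap y xs|} (fun _ => (1 : ℝ)) x

lemma gibbsAverage_largeOverlap_nonneg (lam ε : ℝ) (xs : Fin N → ℝ) (Y : Pairs N → ℝ) :
    0 ≤ gibbsAverage P lam Y (fun x => largeOverlap ε x xs) :=
  div_nonneg (integral_nonneg fun _ =>
    mul_nonneg (Set.indicator_nonneg (fun _ _ => zero_le_one) _) (Real.exp_pos _).le)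
    (integral_nonneg fun _ => (Real.exp_pos _).le)

lemma plantedGibbsMean_largeOverlap_nonneg (lam ε : ℝ) (N : ℕ) :
    0 ≤ plantedGibbsMean P lam N (largeOverlap ε) :=
  integral_nonneg fun _ => gibbsAverage_largeOverlap_nonneg _ _ _ _

lemma plantedGibbsMean_largeOverlap_le_one (hB : ∀ᵐ x ∂P, |x| ≤ B) {lam : ℝ} (hlam : 0 ≤ lam)
    (ε : ℝ) (N : ℕ) : plantedGibbsMean P lam N (largeOverlap ε) ≤ 1 := by
  have h : plantedGibbsMean P lam N (largeOverlap ε) ≤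
      ∫ _, (1 : ℝ) ∂((priorN P N).prod (noiseLaw N)) := by
    refine integral_mono_of_nonneg (Filter.Eventually.of_forall fun _ =>
      gibbsAverage_largeOverlap_nonneg _ _ _ _) (integrable_const _)
      (Filter.Eventually.of_forall fun ω => ?_)
    refine (div_le_one (fullZ_pos hB hlam _)).2 ?_
    exact overlapZ_le_fullZ hB hlam {t | ε ≤ |t|} _ _
  simpa using h

lemma plantedGibbsMean_largeOverlap_le (hB : ∀ᵐ x ∂P, |x| ≤ B) (hB0 : 0 ≤ B) {lam : ℝ}
    (hlam : 0 ≤ lam) {ε b : ℝ} (hb : 0 ≤ b) {A : Set ℝ} (hA : MeasurableSet A)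
    (hsub : {t | ε ≤ |t| ∧ |t| ≤ B * B} ⊆ A) (h : overlapProb P lam N A ≤ ENNReal.ofReal b) :
    plantedGibbsMean P lam N (largeOverlap ε) ≤ b := by
  have key : ‖plantedGibbsMean P lam N (largeOverlap ε)‖ₑ ≤ ENNReal.ofReal b := by
    refine (enorm_integral_le_lintegral_enorm _).trans (le_trans (lintegral_mono_ae ?_) h)
    filter_upwards [Measure.quasiMeasurePreserving_fst.ae (ae_priorN_abs_le hB N)] with ω hω
    rw [Real.enorm_eq_ofReal (gibbsAverage_largeOverlap_nonneg _ _ _ _)]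
    refine ENNReal.ofReal_le_ofReal (div_le_div_of_nonneg_right ?_ (fullZ_pos hB hlam _).le)
    refine integral_mono_of_nonneg (Filter.Eventually.of_forall fun _ =>
      mul_nonneg (Set.indicator_nonneg (fun _ _ => zero_le_one) _) (Real.exp_pos _).le)
      (integrable_indicator_mul_exp_negHamiltonian hB hlam
        (measurableSet_overlap_mem hA ω.1) _) ?_
    filter_upwards [ae_priorN_abs_le hB N] with x hx
    refine mul_le_mul_of_nonneg_right ?_ (Real.exp_pos _).le
    by_cases hε : ε ≤ |overlap x ω.1|
    · have : overlap x ω.1 ∈ A := hsub ⟨hε, abs_overlap_le hB0 hx hω⟩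
      simp [largeOverlap, Set.indicator, hε, this]
    · simp only [largeOverlap, Set.indicator, Set.mem_ofPred_eq, hε, if_false]
      split_ifs <;> norm_num
  rw [Real.enorm_eq_ofReal (plantedGibbsMean_largeOverlap_nonneg _ _ _)] at key
  exact (ENNReal.ofReal_le_ofReal_iff hb).1 key

/-- The overlap is bounded away from zero with exponentially small probability, when there is a
signal. -/
theorem exists_plantedGibbsMean_le_of_pos (hB : ∀ᵐ x ∂P, |x| ≤ B) (hB0 : 0 ≤ B) {lam ε : ℝ}
    (hlam : 0 < lam) (hε : 0 < ε) (hψ : ∀ q : ℝ, 0 < q → psi P (lam * q) < lam * q ^ 2 / 4) :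
    ∃ C c : ℝ, 0 ≤ C ∧ 0 < c ∧ ∀ N : ℕ, 1 ≤ N →
      plantedGibbsMean P lam N (largeOverlap ε) ≤ C * Real.exp (-c * N) := by
  have hK : IsCompact {t : ℝ | ε ≤ |t| ∧ |t| ≤ B * B} := by
    refine (isCompact_Icc (a := -(B * B)) (b := B * B)).of_isClosed_subset ?_
      fun t ht => abs_le.1 ht.2
    exact (isClosed_le continuous_const continuous_abs).inter
      (isClosed_le continuous_abs continuous_const)
  have main : ∃ A : Set ℝ, MeasurableSet A ∧ {t : ℝ | ε ≤ |t| ∧ |t| ≤ B * B} ⊆ A ∧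
      ∃ C c : ℝ, 0 ≤ C ∧ 0 < c ∧ ∀ N : ℕ, 1 ≤ N →
        overlapProb P lam N A ≤ ENNReal.ofReal (C * Real.exp (-c * N)) := by
    refine hK.induction_on (p := fun s => ∃ A : Set ℝ, MeasurableSet A ∧ s ⊆ A ∧
      ∃ C c : ℝ, 0 ≤ C ∧ 0 < c ∧ ∀ N : ℕ, 1 ≤ N →
        overlapProb P lam N A ≤ ENNReal.ofReal (C * Real.exp (-c * N))) ?_ ?_ ?_ ?_
    · refine ⟨∅, MeasurableSet.empty, subset_rfl, 0, 1, le_rfl, one_pos, fun N _ => ?_⟩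
      simp [overlapProb, overlapZ]
    · rintro s t hst ⟨A, hA, hs, h⟩
      exact ⟨A, hA, hst.trans hs, h⟩
    · rintro s t ⟨A, hA, hs, C, c, hC, hc, h⟩ ⟨A', hA', hs', C', c', hC', hc', h'⟩
      refine ⟨A ∪ A', hA.union hA', Set.union_subset_union hs hs', C + C', min c c',
        add_nonneg hC hC', lt_min hc hc', fun N hN => ?_⟩
      refine (overlapProb_union_le hB hlam.le hA hA' N).trans
        ((add_le_add (h N hN) (h' N hN)).trans ?_)
      rw [← ENNReal.ofReal_add (by positivity) (by positivity), add_mul]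
      refine ENNReal.ofReal_le_ofReal (add_le_add ?_ ?_)
      · gcongr
        exact min_le_left _ _
      · gcongr
        exact min_le_right _ _
    · intro x hx
      have hx0 : 0 < |x| := hε.trans_le hx.1
      obtain ⟨σ, hσ, hσx⟩ : ∃ σ : ℝ, |σ| = 1 ∧ σ * |x| = x := by
        rcases abs_choice x with h | h
        · exact ⟨1, by simp, by rw [one_mul, h]⟩
        · exact ⟨-1, by simp, by rw [h]; ring⟩
      obtain ⟨δ, C, c, hδ, hC, hc, h⟩ :=
        exists_overlapProb_ball_le hB hB0 hlam.le hx0.le hσ (hψ _ hx0)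
      rw [hσx] at h
      exact ⟨Metric.ball x δ, mem_nhdsWithin_of_mem_nhds (Metric.ball_mem_nhds x hδ),
        Metric.ball x δ, Metric.isOpen_ball.measurableSet, subset_rfl, C, c, hC, hc, h⟩
  obtain ⟨A, hA, hsub, C, c, hC, hc, h⟩ := main
  exact ⟨C, c, hC, hc, fun N hN =>
    plantedGibbsMean_largeOverlap_le hB hB0 hlam.le (by positivity) hA hsub (h N hN)⟩

/-- Hoeffding's inequality for the overlap of a random vector with a bounded one. -/
lemma integral_largeOverlap_le (hB : ∀ᵐ x ∂P, |x| ≤ B) (hB0 : 0 < B) (hmean : ∫ x, x ∂P = 0)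
    {ε : ℝ} (hε : 0 < ε) (hN : 1 ≤ N) {xs : Fin N → ℝ} (hxs : ∀ i, |xs i| ≤ B) :
    ∫ x, largeOverlap ε x xs ∂(priorN P N) ≤ 2 * Real.exp (-(ε ^ 2 / (2 * B ^ 4)) * N) := by
  have hN0 : (0 : ℝ) < N := by exact_mod_cast hN
  have hsg : ∀ (i : Fin N) (t : ℝ), Integrable (fun y => Real.exp (t * (xs i * y))) P ∧
      ∫ y, Real.exp (t * (xs i * y)) ∂P ≤ Real.exp (B ^ 4 * t ^ 2 / 2) := by
    intro i t
    have h := hasSubgaussianMGF_of_mem_Icc_of_integral_eq_zero (μ := P) (X := fun y => xs i * y)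
      (a := -(B ^ 2)) (b := B ^ 2) (by fun_prop) (by
        filter_upwards [hB] with y hy
        refine abs_le.1 ?_
        rw [abs_mul, pow_two]
        exact mul_le_mul (hxs i) hy (abs_nonneg _) hB0.le)
      (by rw [integral_const_mul, hmean, mul_zero])
    refine ⟨h.integrable_exp_mul t, (h.mgf_le t).trans (le_of_eq ?_)⟩
    congr 3
    simp only [NNReal.coe_pow, NNReal.coe_div, coe_nnnorm, Real.norm_eq_abs, NNReal.coe_ofNat]
    rw [sub_neg_eq_add, abs_of_nonneg (by positivity)]
    ring
  have hprod : ∀ t : ℝ, Integrable (fun x : Fin N → ℝ => ∏ i, Real.exp (t * (xs i * x i)))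
      (priorN P N) ∧ ∫ x, ∏ i, Real.exp (t * (xs i * x i)) ∂(priorN P N) ≤
        Real.exp (B ^ 4 * t ^ 2 / 2 * N) := by
    intro t
    refine ⟨Integrable.fintype_prod (f := fun i (y : ℝ) => Real.exp (t * (xs i * y)))
      fun i => (hsg i t).1, ?_⟩
    have h1 : ∫ x, ∏ i, Real.exp (t * (xs i * x i)) ∂(priorN P N) =
        ∏ i, ∫ y, Real.exp (t * (xs i * y)) ∂P :=
      integral_fintype_prod_eq_prod (fun i (y : ℝ) => Real.exp (t * (xs i * y)))
    rw [h1]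
    refine (Finset.prod_le_prod (fun i _ => integral_nonneg fun _ => (Real.exp_pos _).le)
      fun i _ => (hsg i t).2).trans (le_of_eq ?_)
    rw [Finset.prod_const, Finset.card_univ, Fintype.card_fin, ← Real.exp_nat_mul, mul_comm]
  set h := ε / B ^ 4 with hh
  have hh0 : 0 < h := by positivity
  have hov : ∀ (t : ℝ) (x : Fin N → ℝ),
      ∏ i, Real.exp (t * (xs i * x i)) = Real.exp (t * (N * overlap x xs)) := by
    intro t x
    rw [← Real.exp_sum, ← Finset.mul_sum, overlap, ← mul_assoc (N : ℝ), mul_one_div_cancel hN0.ne',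
      one_mul]
    simp only [mul_comm (x _)]
  have hle : ∫ x, largeOverlap ε x xs ∂(priorN P N) ≤
      ∫ x, Real.exp (-(h * N * ε)) * (∏ i, Real.exp (h * (xs i * x i)) +
        ∏ i, Real.exp (-h * (xs i * x i))) ∂(priorN P N) := by
    refine integral_mono_of_nonneg (Filter.Eventually.of_forall fun _ =>
      Set.indicator_nonneg (fun _ _ => zero_le_one) _)
      (((hprod h).1.add (hprod (-h)).1).const_mul _) (Filter.Eventually.of_forall fun x => ?_)
    simp only [hov]
    have p1 := Real.exp_pos (h * (N * overlap x xs))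
    have p2 := Real.exp_pos (-h * (N * overlap x xs))
    by_cases hx : ε ≤ |overlap x xs|
    · have e0 : largeOverlap ε x xs = 1 := by simp [largeOverlap, Set.indicator, hx]
      have e1 : Real.exp (-(h * N * ε)) * Real.exp (h * N * ε) = 1 := by
        rw [← Real.exp_add]; simp
      rw [e0, ← e1]
      refine mul_le_mul_of_nonneg_left ?_ (Real.exp_pos _).le
      have hhN : 0 < h * N := by positivity
      rcases le_abs.1 hx with h1 | h1
      · have : Real.exp (h * N * ε) ≤ Real.exp (h * (N * overlap x xs)) :=
          Real.exp_le_exp.2 (by nlinarith)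
        linarith
      · have : Real.exp (h * N * ε) ≤ Real.exp (-h * (N * overlap x xs)) :=
          Real.exp_le_exp.2 (by nlinarith)
        linarith
    · have e0 : largeOverlap ε x xs = 0 := by simp [largeOverlap, Set.indicator, hx]
      rw [e0]
      positivity
  rw [integral_const_mul, integral_add (hprod h).1 (hprod (-h)).1] at hle
  have h2 := (hprod h).2
  have h3 := (hprod (-h)).2
  rw [neg_sq] at h3
  calc _ ≤ Real.exp (-(h * N * ε)) * (Real.exp (B ^ 4 * h ^ 2 / 2 * N) +
        Real.exp (B ^ 4 * h ^ 2 / 2 * N)) :=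
        hle.trans (mul_le_mul_of_nonneg_left (add_le_add h2 h3) (Real.exp_pos _).le)
    _ = 2 * (Real.exp (-(h * N * ε)) * Real.exp (B ^ 4 * h ^ 2 / 2 * N)) := by ring
    _ = _ := by
        rw [← Real.exp_add]
        congr 2
        rw [hh]
        field_simp
        ring

lemma gibbsAverage_zero (Y : Pairs N → ℝ) (f : (Fin N → ℝ) → ℝ) :
    gibbsAverage P 0 Y f = ∫ x, f x ∂(priorN P N) := by
  simp [gibbsAverage, negHamiltonian]

lemma plantedGibbsMean_zero_le (hB : ∀ᵐ x ∂P, |x| ≤ B) (hB0 : 0 < B) (hmean : ∫ x, x ∂P = 0)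
    {ε : ℝ} (hε : 0 < ε) (hN : 1 ≤ N) :
    plantedGibbsMean P 0 N (largeOverlap ε) ≤ 2 * Real.exp (-(ε ^ 2 / (2 * B ^ 4)) * N) := by
  have h : plantedGibbsMean P 0 N (largeOverlap ε) ≤
      ∫ _, 2 * Real.exp (-(ε ^ 2 / (2 * B ^ 4)) * N) ∂((priorN P N).prod (noiseLaw N)) := by
    refine integral_mono_of_nonneg (Filter.Eventually.of_forall fun _ =>
      gibbsAverage_largeOverlap_nonneg _ _ _ _) (integrable_const _) ?_
    filter_upwards [Measure.quasiMeasurePreserving_fst.ae (ae_priorN_abs_le hB N)] with ω hω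
    rw [gibbsAverage_zero]
    exact integral_largeOverlap_le hB hB0 hmean hε hN hω
  simpa using h

end Assembly

lemma exists_le_two_mul_exp {p : ℕ → ℝ} (h0 : ∀ N, 0 ≤ p N) (h1 : ∀ N, p N ≤ 1) {C c : ℝ}
    (hc : 0 < c) (h : ∀ N : ℕ, 1 ≤ N → p N ≤ C * Real.exp (-c * N)) :
    ∃ c' : ℝ, 0 < c' ∧ ∀ N : ℕ, 1 ≤ N → p N ≤ 2 * Real.exp (-c' * N) := by
  set L := Real.log (max C 2) with hL
  have hM : 0 < max C 2 := lt_max_of_lt_right two_pos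
  have h2 : (0 : ℝ) < Real.log 2 := Real.log_pos one_lt_two
  have hL2 : Real.log 2 ≤ L := Real.log_le_log two_pos (le_max_right _ _)
  have hL0 : 0 < L := h2.trans_le hL2
  set τ := Real.log 2 / L with hτ
  have hτ0 : 0 < τ := div_pos h2 hL0
  have hτ1 : τ ≤ 1 := (div_le_one hL0).2 hL2
  refine ⟨τ * c, by positivity, fun N hN => ?_⟩
  calc p N = p N ^ (1 : ℝ) := (Real.rpow_one _).symm
    _ ≤ p N ^ τ := Real.rpow_le_rpow_of_exponent_ge_of_imp (h0 N) (h1 N) hτ1 (by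
        intro _ h; norm_num at h)
    _ ≤ (max C 2 * Real.exp (-c * N)) ^ τ := Real.rpow_le_rpow (h0 N)
        ((h N hN).trans (mul_le_mul_of_nonneg_right (le_max_left _ _) (Real.exp_pos _).le)) hτ0.le
    _ = 2 * Real.exp (-(τ * c) * N) := by
        rw [Real.mul_rpow hM.le (Real.exp_pos _).le, ← Real.exp_mul, Real.rpow_def_of_pos hM,
          ← hL, hτ, mul_div_cancel₀ _ hL0.ne', Real.exp_log two_pos]
        ring_nf

end SpikedWigner

theorem mainTheorem4 (lam : ℝ) (hlam : 0 ≤ lam) (ε : ℝ) (hε : 0 < ε) :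
    ∃ K : ℝ, 0 ≤ K ∧
      ∀ (P : MeasureTheory.Measure ℝ) [MeasureTheory.IsProbabilityMeasure P],
        SpikedWigner.HasBoundedSupport P →
        ENNReal.ofReal lam < SpikedWigner.reconstructionThreshold P →
        ∃ c : ℝ, 0 < c ∧ ∀ N : ℕ, 1 ≤ N →
          SpikedWigner.plantedGibbsMean P lam N
              (fun x xs => Set.indicator {y : Fin N → ℝ | ε ≤ |SpikedWigner.overlap y xs|}
                (fun _ => (1 : ℝ)) x)
            ≤ K * Real.exp (-c * (N : ℝ)) := by
  refine ⟨2, two_pos.le, fun P _ hbdd hthr => ?_⟩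
  obtain ⟨B₀, hB₀⟩ := hbdd
  set B := max B₀ 1
  have hB : ∀ᵐ x ∂P, |x| ≤ B := hB₀.mono fun x hx => hx.trans (le_max_left _ _)
  have hB0 : 0 < B := lt_max_of_lt_right one_pos
  obtain ⟨lam', hlt, hψ⟩ := SpikedWigner.exists_psi_lt_of_lt_reconstructionThreshold hthr
  rcases hlam.eq_or_lt with h0 | hpos
  · subst h0
    have hmean := SpikedWigner.integral_eq_zero_of_psi_lt hB hB0.le hlt hψ
    exact ⟨ε ^ 2 / (2 * B ^ 4), by positivity, fun N hN =>
      SpikedWigner.plantedGibbsMean_zero_le hB hB0 hmean hε hN⟩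
  · have hψ' : ∀ q : ℝ, 0 < q → SpikedWigner.psi P (lam * q) < lam * q ^ 2 / 4 := by
      intro q hq
      refine (hψ (lam * q) (by positivity)).trans_le ?_
      have hlam' : 0 < lam' := hpos.trans hlt
      rw [div_le_div_iff₀ (by positivity) (by norm_num)]
      have : 0 ≤ lam * q ^ 2 * (lam' - lam) := mul_nonneg (by positivity) (by linarith)
      nlinarith
    obtain ⟨C, c, -, hc, h⟩ :=
      SpikedWigner.exists_plantedGibbsMean_le_of_pos hB hB0.le hpos hε hψ'
    exact SpikedWigner.exists_le_two_mul_exp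
      (p := fun N => SpikedWigner.plantedGibbsMean P lam N (SpikedWigner.largeOverlap ε))
      (fun N => SpikedWigner.plantedGibbsMean_largeOverlap_nonneg lam ε N)
      (fun N => SpikedWigner.plantedGibbsMean_largeOverlap_le_one hB hlam ε N) hc h
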